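/- **Distance-query model.** A graph $G$ on the known vertex set $[n]$ is hidden. An algorithm adaptively asks queries: a query names two vertices $u,v$, and an oracle answers the distance $d_G(u,v)$ ($\infty$ if $u$ and $v$ lie in different components). The algorithm reconstructs $G$ if it outputs $G$; its cost is the number of queries it asks. **Theorem.** There is an absolute constant $C$ such that for every $\varepsilon \ge 0$, every $n \in \mathbb{N}$ and every $p\in[0,1]$ with $\frac{2000\log n}{n} \le p \le n^{-1/2-\varepsilon}$, the following holds with $\Delta = (n-1)p$. Consider the randomized algorithm that 1. chooses a uniformly random set $S$ of $\min\bigl(n, \lceil 3\Delta^2\log n\rceil\bigr)$ vertices and queries all pairs in $S\times [n]$; 2. then queries every pair $\{u,v\}$ of distinct vertices that is not ruled out as a non-edge by some $s\in S$, where $s$ rules out $\{u,v\}$ if $d_G(s,u)$ and $d_G(s,v)$ differ by at least $2$ (a finite and an infinite distance count as differing by at least $2$, two infinite ones do not), and outputs the graph whose edges are the pairs that were found in this second step to be at distance $1$. This algorithm outputs $G$ for every graph $G$ on $[n]$ and every choice of $S$. If $G\sim G(n,p)$, with $S$ chosen independently of $G$, then the expected number of queries it asks (repetitions included) is at most $C\,\Delta^2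 n\log n$. -/

import Mathlib

open scoped ENNReal

/-! ### The distance query model -/

namespace DistanceQuery

/-- A deterministic adaptive algorithm in the distance query model on a known vertex set `V`, as a
decision tree: it stops with an output, or asks for the distance between two vertices and continues
in a way that depends on the answer (`⊤` is the distance between different components). -/
inductive Algorithm (V : Type) (α : Type) : Type where
  | output (a : α) : Algorithm V α
  | query (u v : V) (next : ℕ∞ → Algorithm V α) : Algorithm V α

namespace Algorithm

variable {V α : Type}

/-- The output of an algorithm when the oracle answers with the distances in the hidden graph. -/
noncomputable def run (G : SimpleGraph V) : Algorithm V α → α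
  | output a => a
  | query u v next => run G (next (G.edist u v))

/-- The number of queries (repetitions included) that an algorithm makes on a hidden graph. -/
noncomputable def queries (G : SimpleGraph V) : Algorithm V α → ℕ
  | output _ => 0
  | query u v next => queries G (next (G.edist u v)) + 1

/-- Ask for the distances of all pairs in a list, one query for each entry, record the answers in
the table `d`, and continue with the resulting table. -/
def askAll [DecidableEq V] :
    List (V × V) → (d : V → V → ℕ∞) → (next : (V → V → ℕ∞) → Algorithm V α) → Algorithm V α
  | [], d, next => next d
  | (u, v) :: l, d, next =>
      query u v fun a => askAll l (fun x y => if x = u ∧ y = v then a else d x y) next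

end Algorithm

/-- A randomized algorithm for graph reconstruction on the vertex set `Fin n`: a random
deterministic algorithm, whose output is a graph. -/
abbrev RandomizedAlgorithm (n : ℕ) : Type :=
  PMF (Algorithm (Fin n) (SimpleGraph (Fin n)))

/-- The algorithm outputs the hidden graph, for every hidden graph and every outcome of its random
choices. -/
def RandomizedAlgorithm.Reconstructs {n : ℕ} (A : RandomizedAlgorithm n) : Prop :=
  ∀ T ∈ A.support, ∀ G : SimpleGraph (Fin n), T.run G = G

/-- The expected number of queries on a hidden graph distributed as `G(n, p)`; the expectation is
over the hidden graph and over the random choices of the algorithm, which are independent. -/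
noncomputable def RandomizedAlgorithm.expectedQueries {n : ℕ} (A : RandomizedAlgorithm n)
    (p : unitInterval) : ℝ≥0∞ :=
  ∫⁻ G, ∑' T, A T * (T.queries G : ℝ≥0∞) ∂(SimpleGraph.binomialRandom (Fin n) p)

/-! ### The algorithm -/

/-- The pairs `u < v` such that no `s ∈ S` has distances to `u` and to `v` that differ by at least
two, according to the table `d`. -/
noncomputable def pseudoEdges {n : ℕ} (S : Finset (Fin n)) (d : Fin n → Fin n → ℕ∞) :
    Finset (Fin n × Fin n) :=
  {e | e.1 < e.2 ∧ ∀ s ∈ S, d s e.1 ≤ d s e.2 + 1 ∧ d s e.2 ≤ d s e.1 + 1}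

/-- Query every vertex of `S` against all vertices; then query every pair that these answers do not
rule out as a non-edge, and output the graph of the pairs found at distance one. -/
noncomputable def pseudoEdgeAlgorithm {n : ℕ} (S : Finset (Fin n)) :
    Algorithm (Fin n) (SimpleGraph (Fin n)) :=
  .askAll (S ×ˢ Finset.univ).toList (fun _ _ => 0) fun d =>
    .askAll (pseudoEdges S d).toList (fun _ _ => 0) fun d' =>
      .output (SimpleGraph.fromRel fun u v => (u, v) ∈ pseudoEdges S d ∧ d' u v = 1)

/-- The algorithm above for a uniformly random set `S` of `min n m` vertices. -/
noncomputable def randomPseudoEdgeAlgorithm (n m : ℕ) : RandomizedAlgorithm n :=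
  (PMF.uniformOfFinset ((Finset.univ : Finset (Fin n)).powersetCard (min n m))
    (Finset.powersetCard_nonempty.2 (by simp))).map pseudoEdgeAlgorithm

end DistanceQuery

/-! Querying S costs about 3Δ²n log n, so the point is that few pairs survive to the second step.
Edges always survive, since distances to adjacent vertices differ by at most one; this gives
correctness, and there are only about Δn edges in expectation. For a non-edge {u, v} it suffices
that at least n/(3Δ²) vertices rule it out, except with probability 2/n
(`Regime.integral_few_distinguishing_le`): a random S of size 3Δ² log n then misses all of them with
probability at most 1/n (`choose_sub_le_exp`), and the surviving non-edges contribute O(n) in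
expectation.

Let D = Δ + 1 and D^(k+2) ≤ n < D^(k+3). Run breadth-first search from v in G - u for k + 1 rounds.
By an exponential supermartingale it finds at most 2D^(k+1) vertices, except with probability
exp(-Δ/6) (`integral_discovered_gt_le`). Then grow layers from u among the vertices not found: k
layers that grow by almost Δ each, and a last one that keeps only vertices without neighbours in the
final layer Y of the first search. As |Y|p ≤ 2, avoiding Y costs at most a constant factor, and the
last layer has at least n/(3Δ²) vertices with high probability.

A vertex s of the last layer has d(u,s) ≤ k + 1, and no path from v that avoids u reaches it within
k + 2 steps. So either d(v,s) ≥ k + 3, or a shortest path from v to s passes through u and d(v,s) ≥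
d(v,u) + d(u,s) ≥ 2 + d(u,s). In both cases s rules out {u, v} (`Grows.le_card_distinguishes`). If n
< D², the single vertex u is already enough.

Independence comes from deferred decisions (`integral_reveal_le`): the outcome of each stage is
determined by edges disjoint from those that later stages inspect. -/

open MeasureTheory ProbabilityTheory

namespace DistanceQuery

/-! ### Indicators -/

/-- The indicator of a proposition, as a real number. -/
noncomputable def ind (P : Prop) : ℝ := open Classical in if P then 1 else 0

lemma ind_true {P : Prop} (h : P) : ind P = 1 := by simp [ind, h]

lemma ind_false {P : Prop} (h : ¬ P) : ind P = 0 := by simp [ind, h]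

lemma ind_nonneg (P : Prop) : 0 ≤ ind P := by unfold ind; split_ifs <;> norm_num

lemma ind_le_one (P : Prop) : ind P ≤ 1 := by unfold ind; split_ifs <;> norm_num

lemma ind_mono {P Q : Prop} (h : P → Q) : ind P ≤ ind Q := by
  by_cases hP : P
  · rw [ind_true hP, ind_true (h hP)]
  · rw [ind_false hP]; exact ind_nonneg Q

lemma ind_not (P : Prop) : ind (¬ P) = 1 - ind P := by
  by_cases hP : P <;> simp [ind, hP]

lemma ind_and (P Q : Prop) : ind (P ∧ Q) = ind P * ind Q := by
  by_cases hP : P <;> by_cases hQ : Q <;> simp [ind, hP, hQ]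

lemma ind_or_le (P Q : Prop) : ind (P ∨ Q) ≤ ind P + ind Q := by
  by_cases hP : P <;> by_cases hQ : Q <;> simp [ind, hP, hQ]

/-! ### Functions of a random graph that depend on few edges -/

section Random

variable {V : Type*}

/-- `f` depends only on the presence of the edges in `D`. -/
def DependsOnEdges {α : Type*} (D : Set (Sym2 V)) (f : SimpleGraph V → α) : Prop :=
  ∀ G H : SimpleGraph V, (∀ e ∈ D, e ∈ G.edgeSet ↔ e ∈ H.edgeSet) → f G = f H

lemma DependsOnEdges.mono {α : Type*} {D D' : Set (Sym2 V)} {f : SimpleGraph V → α}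
    (h : DependsOnEdges D f) (hD : D ⊆ D') : DependsOnEdges D' f :=
  fun G H hGH => h G H fun e he => hGH e (hD he)

lemma DependsOnEdges.comp {α β : Type*} {D : Set (Sym2 V)} {f : SimpleGraph V → α}
    (h : DependsOnEdges D f) (g : α → β) : DependsOnEdges D fun G => g (f G) :=
  fun G H hGH => congrArg g (h G H hGH)

lemma DependsOnEdges.comp₂ {α β γ : Type*} {D : Set (Sym2 V)} {f : SimpleGraph V → α}
    {f' : SimpleGraph V → β} (h : DependsOnEdges D f) (h' : DependsOnEdges D f')
    (g : α → β → γ) : DependsOnEdges D fun G => g (f G) (f' G) :=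
  fun G H hGH => congrArg₂ g (h G H hGH) (h' G H hGH)

lemma dependsOnEdges_adj (a b : V) :
    DependsOnEdges {s(a, b)} (fun G : SimpleGraph V => G.Adj a b) := by
  intro G H h
  simpa using h s(a, b) rfl

lemma measurable_fromEdgeSet_setOf :
    Measurable fun q : Sym2 V → Prop => SimpleGraph.fromEdgeSet {i | q i} :=
  SimpleGraph.measurable_fromEdgeSet.comp MeasurableEquiv.setOfPred.measurable

variable [Fintype V]

/-- Since there are finitely many graphs, this makes every function of the graph measurable and
integrable. -/
instance : MeasurableSingletonClass (SimpleGraph V) where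
  measurableSet_singleton G := by
    have : ({G} : Set (SimpleGraph V)) =
        ⋂ u, ⋂ v, {H : SimpleGraph V | H.Adj u v} ∩ {H : SimpleGraph V | G.Adj u v} ∪
          {H : SimpleGraph V | H.Adj u v}ᶜ ∩ {H : SimpleGraph V | ¬ G.Adj u v} := by
      ext H
      simp only [Set.mem_singleton_iff, Set.mem_iInter, Set.mem_union, Set.mem_inter_iff,
        Set.mem_ofPred_eq, Set.mem_compl_iff]
      constructor
      · rintro rfl u v
        tauto
      · intro h
        ext u v
        have := h u v
        tauto
    rw [this]
    have hm : ∀ u v : V, MeasurableSet {H : SimpleGraph V | H.Adj u v} := fun u v =>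
      measurableSet_setOfPred.2 (SimpleGraph.measurable_iff_adj.1 measurable_id u v)
    refine MeasurableSet.iInter fun u => MeasurableSet.iInter fun v => ?_
    exact ((hm u v).inter (.const _)).union ((hm u v).compl.inter (.const _))

/-- The law of a single potential edge of the binomial random graph. -/
noncomputable def edgeLaw (p : unitInterval) (e : Sym2 V) : Measure Prop :=
  unitInterval.toNNReal p • Measure.dirac (e ∈ (Sym2.diagSetᶜ : Set (Sym2 V))) +
    unitInterval.toNNReal (unitInterval.symm p) • Measure.dirac False

instance (p : unitInterval) (e : Sym2 V) : IsProbabilityMeasure (edgeLaw p e) := by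
  constructor
  simp [edgeLaw]

lemma integral_graph_eq (p : unitInterval) (f : SimpleGraph V → ℝ) :
    ∫ G, f G ∂(SimpleGraph.binomialRandom V p) =
      ∫ q, f (SimpleGraph.fromEdgeSet {i | q i}) ∂(Measure.infinitePi (edgeLaw (V := V) p)) := by
  have hμ : SimpleGraph.binomialRandom V p = (Measure.infinitePi (edgeLaw p)).map
      (fun q => SimpleGraph.fromEdgeSet {i | q i}) := by
    rw [SimpleGraph.binomialRandom_eq_map, setBernoulli_eq_map, Measure.map_map]
    · rfl
    · exact SimpleGraph.measurable_fromEdgeSet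
    · exact MeasurableEquiv.setOfPred.measurable
  rw [hμ, integral_map measurable_fromEdgeSet_setOf.aemeasurable
    (measurable_of_finite f).aestronglyMeasurable]

/-- Functions that depend on disjoint sets of edges are independent. -/
lemma integral_mul_of_dependsOnEdges (p : unitInterval) {D₁ D₂ : Set (Sym2 V)}
    (hD : Disjoint D₁ D₂) {f g : SimpleGraph V → ℝ} (hf : DependsOnEdges D₁ f)
    (hg : DependsOnEdges D₂ g) :
    ∫ G, f G * g G ∂(SimpleGraph.binomialRandom V p) =
      (∫ G, f G ∂(SimpleGraph.binomialRandom V p)) *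
        ∫ G, g G ∂(SimpleGraph.binomialRandom V p) := by
  classical
  rw [integral_graph_eq, integral_graph_eq, integral_graph_eq]
  have key : ∀ (D : Set (Sym2 V)) (f : SimpleGraph V → ℝ), DependsOnEdges D f →
      ∃ f' : ((i : D.toFinset) → Prop) → ℝ,
        ∀ q : Sym2 V → Prop, f (SimpleGraph.fromEdgeSet {i | q i}) = f' (fun i => q i) := by
    intro D f hf
    -- Edges outside `D` are declared absent, which `f` cannot notice.
    refine ⟨fun r => f (SimpleGraph.fromEdgeSet {i | ∃ h : i ∈ D.toFinset, r ⟨i, h⟩}), ?_⟩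
    intro q
    apply hf
    intro e he
    simp only [SimpleGraph.edgeSet_fromEdgeSet, Set.mem_sdiff, Set.mem_ofPred_eq, Set.mem_toFinset]
    simp [he]
  obtain ⟨f', hf'⟩ := key D₁ f hf
  obtain ⟨g', hg'⟩ := key D₂ g hg
  have hind := (iIndepFun_infinitePi (P := edgeLaw (V := V) p) (X := fun i (x : Prop) => x)
    (fun i => measurable_id)).indepFun_finset D₁.toFinset D₂.toFinset
    (by simpa using hD) (fun i => measurable_pi_apply i)
  have hind2 := hind.comp (φ := f') (ψ := g') (measurable_of_finite _) (measurable_of_finite _)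
  have := hind2.integral_fun_mul_eq_mul_integral
    (Measurable.aestronglyMeasurable (measurable_of_finite _))
    (Measurable.aestronglyMeasurable (measurable_of_finite _))
  simpa [hf', hg', Function.comp_def] using this

lemma integrable_graph (p : unitInterval) (f : SimpleGraph V → ℝ) :
    Integrable f (SimpleGraph.binomialRandom V p) := .of_finite

lemma integral_graph_mono (p : unitInterval) {f g : SimpleGraph V → ℝ} (h : ∀ G, f G ≤ g G) :
    ∫ G, f G ∂(SimpleGraph.binomialRandom V p) ≤ ∫ G, g G ∂(SimpleGraph.binomialRandom V p) :=
  integral_mono (integrable_graph p f) (integrable_graph p g) h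

lemma integral_graph_const (p : unitInterval) (c : ℝ) :
    ∫ _G : SimpleGraph V, c ∂(SimpleGraph.binomialRandom V p) = c := by simp

/-- To bound the expectation of `F (X G) G`, it suffices to bound the expectation of `F x` for
every value `x` of `X`, if the event `X = x` and the function `F x` depend on disjoint sets of
edges. -/
lemma integral_reveal_le (p : unitInterval) {σ : Type*} [Finite σ] (X : SimpleGraph V → σ)
    (F : σ → SimpleGraph V → ℝ) (b : σ → ℝ) (D : σ → Set (Sym2 V))
    (hX : ∀ x, DependsOnEdges (D x)ᶜ fun G => X G = x)
    (hF : ∀ x, DependsOnEdges (D x) (F x))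
    (hb : ∀ G, ∫ H, F (X G) H ∂(SimpleGraph.binomialRandom V p) ≤ b (X G)) :
    ∫ G, F (X G) G ∂(SimpleGraph.binomialRandom V p) ≤
      ∫ G, b (X G) ∂(SimpleGraph.binomialRandom V p) := by
  classical
  have := Fintype.ofFinite σ
  have h1 : ∀ φ : σ → SimpleGraph V → ℝ, ∀ G, φ (X G) G = ∑ x, ind (X G = x) * φ x G := by
    intro φ G
    rw [Finset.sum_eq_single (X G)]
    · rw [ind_true rfl, one_mul]
    · intro x _ hx
      rw [ind_false (Ne.symm hx), zero_mul]
    · simp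
  calc ∫ G, F (X G) G ∂(SimpleGraph.binomialRandom V p)
      = ∑ x, ∫ G, ind (X G = x) * F x G ∂(SimpleGraph.binomialRandom V p) := by
        simp_rw [h1 F]
        rw [integral_finsetSum _ fun x _ => integrable_graph p _]
    _ ≤ ∑ x, ∫ G, ind (X G = x) * b x ∂(SimpleGraph.binomialRandom V p) := by
        refine Finset.sum_le_sum fun x _ => ?_
        rw [integral_mul_of_dependsOnEdges p disjoint_compl_left ((hX x).comp ind) (hF x),
          integral_mul_const]
        -- The hypothesis `hb` speaks only of attained values; the indicator of any other value
        -- vanishes.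
        by_cases hx : ∃ G, X G = x
        · obtain ⟨G, rfl⟩ := hx
          exact mul_le_mul_of_nonneg_left (hb G) (integral_nonneg fun G => ind_nonneg _)
        · have : ∀ G, ind (X G = x) = 0 := fun G => ind_false fun h => hx ⟨G, h⟩
          simp [this]
    _ = ∫ G, b (X G) ∂(SimpleGraph.binomialRandom V p) := by
        simp_rw [h1 fun x _ => b x]
        rw [integral_finsetSum _ fun x _ => integrable_graph p _]

/-- The probability of an edge. -/
lemma integral_ind_adj (p : unitInterval) {a b : V} (hab : a ≠ b) :
    ∫ G, ind (G.Adj a b) ∂(SimpleGraph.binomialRandom V p) = p := by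
  have h1 : ∀ q : Sym2 V → Prop,
      ind ((SimpleGraph.fromEdgeSet {i | q i}).Adj a b) = ind (q s(a, b)) := by
    intro q
    simp [SimpleGraph.fromEdgeSet_adj, hab]
  simp_rw [integral_graph_eq, h1]
  have hpres := measurePreserving_eval_infinitePi (edgeLaw (V := V) p) s(a, b)
  have := integral_map (μ := Measure.infinitePi (edgeLaw (V := V) p)) hpres.measurable.aemeasurable
    (measurable_of_finite ind).aestronglyMeasurable
  rw [hpres.map_eq] at this
  rw [← this, edgeLaw, integral_add_measure .of_finite .of_finite, integral_smul_nnreal_measure,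
    integral_smul_nnreal_measure, integral_dirac, integral_dirac, ind_false not_false,
    ind_true (by simpa using hab)]
  simp [NNReal.smul_def]

end Random

/-! ### Edges between vertex sets, and tail bounds for a single layer -/

section Frontier

variable {V : Type*}

/-- The edges between `B` and `W`. -/
def edgesBetween (B W : Finset V) : Set (Sym2 V) := {e | ∃ b ∈ B, ∃ w ∈ W, e = s(b, w)}

lemma edgesBetween_mono {B B' W W' : Finset V} (hB : B ⊆ B') (hW : W ⊆ W') :
    edgesBetween B W ⊆ edgesBetween B' W' := by
  rintro e ⟨b, hb, w, hw, rfl⟩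
  exact ⟨b, hB hb, w, hW hw, rfl⟩

open Classical in
/-- The vertices of `W` with a neighbour in `A` and none in `Y`. -/
noncomputable def frontier (G : SimpleGraph V) (A Y W : Finset V) : Finset V :=
  W.filter fun s => (∃ a ∈ A, G.Adj a s) ∧ ∀ y ∈ Y, ¬ G.Adj y s

lemma mem_frontier {G : SimpleGraph V} {A Y W : Finset V} {s : V} :
    s ∈ frontier G A Y W ↔ s ∈ W ∧ (∃ a ∈ A, G.Adj a s) ∧ ∀ y ∈ Y, ¬ G.Adj y s := by
  simp [frontier]

lemma frontier_subset (G : SimpleGraph V) (A Y W : Finset V) : frontier G A Y W ⊆ W :=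
  fun _ h => (mem_frontier.1 h).1

lemma dependsOnEdges_forall_not_adj (Y : Finset V) (s : V) :
    DependsOnEdges (edgesBetween Y {s}) fun G : SimpleGraph V => ∀ y ∈ Y, ¬ G.Adj y s := by
  intro G H h
  refine propext (forall₂_congr fun y hy => not_congr ?_)
  simpa using h s(y, s) ⟨y, hy, s, by simp, rfl⟩

lemma dependsOnEdges_exists_adj (Y : Finset V) (s : V) :
    DependsOnEdges (edgesBetween Y {s}) fun G : SimpleGraph V => ∃ y ∈ Y, G.Adj y s := by
  intro G H h
  refine propext (exists_congr fun y => and_congr_right fun hy => ?_)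
  simpa using h s(y, s) ⟨y, hy, s, by simp, rfl⟩

lemma dependsOnEdges_frontier [DecidableEq V] (A Y W : Finset V) :
    DependsOnEdges (edgesBetween (A ∪ Y) W) fun G : SimpleGraph V => frontier G A Y W := by
  intro G H h
  ext s
  simp only [mem_frontier]
  refine and_congr_right fun hs => ?_
  have h1 := dependsOnEdges_exists_adj A s G H fun e he => h e
    (edgesBetween_mono Finset.subset_union_left (by simpa using hs) he)
  have h2 := dependsOnEdges_forall_not_adj Y s G H fun e he => h e
    (edgesBetween_mono Finset.subset_union_right (by simpa using hs) he)
  exact and_congr h1.to_iff h2.to_iff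

/-- Edges are unordered, so endpoints can match straight or crossed; each hypothesis excludes one of
the two. -/
lemma disjoint_edgesBetween {B W B' W' : Finset V} (h : Disjoint B B' ∨ Disjoint W W')
    (h' : Disjoint B W' ∨ Disjoint W B') :
    Disjoint (edgesBetween B W) (edgesBetween B' W') := by
  rw [Set.disjoint_left]
  rintro e ⟨b, hb, w, hw, rfl⟩ ⟨b', hb', w', hw', he⟩
  rcases Sym2.eq_iff.1 he with ⟨rfl, rfl⟩ | ⟨rfl, rfl⟩
  · rcases h with h | h
    · exact Finset.disjoint_left.1 h hb hb'
    · exact Finset.disjoint_left.1 h hw hw'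
  · rcases h' with h | h
    · exact Finset.disjoint_left.1 h hb hw'
    · exact Finset.disjoint_left.1 h hw hb'

variable [Fintype V]

lemma integral_forall_not_adj [DecidableEq V] (p : unitInterval) (Y : Finset V) (s : V)
    (hs : s ∉ Y) :
    ∫ G, ind (∀ y ∈ Y, ¬ G.Adj y s) ∂(SimpleGraph.binomialRandom V p) = (1 - p : ℝ) ^ Y.card := by
  induction Y using Finset.induction_on with
  | empty => simp [ind_true]
  | insert y Y hy ih =>
    rw [Finset.mem_insert, not_or] at hs
    have h1 : ∀ G : SimpleGraph V, ind (∀ z ∈ insert y Y, ¬ G.Adj z s) =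
        ind (¬ G.Adj y s) * ind (∀ z ∈ Y, ¬ G.Adj z s) := by
      intro G
      rw [← ind_and, Finset.forall_mem_insert]
    simp_rw [h1]
    rw [integral_mul_of_dependsOnEdges p (D₁ := edgesBetween {y} {s}) (D₂ := edgesBetween Y {s}),
      ih hs.2, Finset.card_insert_of_notMem hy, pow_succ']
    · congr 1
      simp_rw [ind_not]
      rw [integral_sub (integrable_graph p _) (integrable_graph p _),
        integral_ind_adj p (Ne.symm hs.1), integral_graph_const]
    · exact disjoint_edgesBetween (.inl (by simpa using hy)) (.inl (by simpa using Ne.symm hs.1))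
    · refine ((dependsOnEdges_adj y s).comp (fun q => ind (¬ q))).mono ?_
      rintro e rfl
      exact ⟨y, by simp, s, by simp, rfl⟩
    · exact (dependsOnEdges_forall_not_adj Y s).comp ind

/-- The probability that a vertex has a neighbour in a set of size `a` and none in a disjoint set
of size `y`. -/
def frontierProb (p : ℝ) (a y : ℕ) : ℝ := (1 - (1 - p) ^ a) * (1 - p) ^ y

lemma integral_mem_frontier [DecidableEq V] (p : unitInterval) {A Y : Finset V} {s : V}
    (hA : s ∉ A) (hY : s ∉ Y) (hAY : Disjoint A Y) :
    ∫ G, ind ((∃ a ∈ A, G.Adj a s) ∧ ∀ y ∈ Y, ¬ G.Adj y s) ∂(SimpleGraph.binomialRandom V p) =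
      frontierProb p A.card Y.card := by
  have h1 : ∀ G : SimpleGraph V, ind ((∃ a ∈ A, G.Adj a s) ∧ ∀ y ∈ Y, ¬ G.Adj y s) =
      (1 - ind (∀ a ∈ A, ¬ G.Adj a s)) * ind (∀ y ∈ Y, ¬ G.Adj y s) := by
    intro G
    rw [ind_and, ← ind_not]
    push Not
    rfl
  simp_rw [h1]
  rw [integral_mul_of_dependsOnEdges p (D₁ := edgesBetween A {s}) (D₂ := edgesBetween Y {s}),
    integral_forall_not_adj p Y s hY,
    integral_sub (integrable_graph p _) (integrable_graph p _), integral_forall_not_adj p A s hA,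
    integral_graph_const, frontierProb]
  · exact disjoint_edgesBetween (.inl hAY) (.inl (by simpa using hA))
  · exact (dependsOnEdges_forall_not_adj A s).comp (fun q => 1 - ind q)
  · exact (dependsOnEdges_forall_not_adj Y s).comp ind

/-- The moment generating function of the size of the frontier. -/
lemma integral_exp_card_frontier [DecidableEq V] (p : unitInterval) (t : ℝ) {A Y W : Finset V}
    (hAY : Disjoint A Y) (hAW : Disjoint A W) (hYW : Disjoint Y W) :
    ∫ G, Real.exp (t * (frontier G A Y W).card) ∂(SimpleGraph.binomialRandom V p) =
      (1 + (Real.exp t - 1) * frontierProb p A.card Y.card) ^ W.card := by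
  induction W using Finset.induction_on with
  | empty => simp [frontier]
  | insert s W hs ih =>
    rw [Finset.disjoint_insert_right] at hAW hYW
    -- The vertex `s` contributes a factor that depends only on its own edges to `A ∪ Y`, so the
    -- factors of distinct vertices are independent.
    have h1 : ∀ G : SimpleGraph V, Real.exp (t * (frontier G A Y (insert s W)).card) =
        (1 + (Real.exp t - 1) * ind ((∃ a ∈ A, G.Adj a s) ∧ ∀ y ∈ Y, ¬ G.Adj y s)) *
          Real.exp (t * (frontier G A Y W).card) := by
      intro G
      by_cases h : (∃ a ∈ A, G.Adj a s) ∧ ∀ y ∈ Y, ¬ G.Adj y s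
      · have : frontier G A Y (insert s W) = insert s (frontier G A Y W) := by
          simp only [frontier, Finset.filter_insert, if_pos h]
        rw [this, Finset.card_insert_of_notMem fun h' => hs (frontier_subset _ _ _ _ h'),
          ind_true h]
        push_cast
        rw [mul_add, Real.exp_add]
        ring_nf
      · have : frontier G A Y (insert s W) = frontier G A Y W := by
          simp only [frontier, Finset.filter_insert, if_neg h]
        rw [this, ind_false h]
        ring
    simp_rw [h1]
    rw [integral_mul_of_dependsOnEdges p (D₁ := edgesBetween (A ∪ Y) {s})
      (D₂ := edgesBetween (A ∪ Y) W), ih hAW.2 hYW.2, Finset.card_insert_of_notMem hs, pow_succ']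
    · congr 1
      rw [integral_add (integrable_graph p _) (integrable_graph p _), integral_graph_const,
        integral_const_mul, integral_mem_frontier p hAW.1 hYW.1 hAY]
    · exact disjoint_edgesBetween (.inr (by simpa using hs))
        (.inr (by simp [hAW.1, hYW.1]))
    · refine DependsOnEdges.comp (f := fun G : SimpleGraph V =>
        (∃ a ∈ A, G.Adj a s) ∧ ∀ y ∈ Y, ¬ G.Adj y s) ?_ fun q => 1 + (Real.exp t - 1) * ind q
      exact ((dependsOnEdges_exists_adj A s).mono
        (edgesBetween_mono Finset.subset_union_left le_rfl)).comp₂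
        ((dependsOnEdges_forall_not_adj Y s).mono
        (edgesBetween_mono Finset.subset_union_right le_rfl)) And
    · exact (dependsOnEdges_frontier A Y W).comp fun S => Real.exp (t * S.card)

lemma frontierProb_nonneg {p : ℝ} (h0 : 0 ≤ p) (h1 : p ≤ 1) (a y : ℕ) :
    0 ≤ frontierProb p a y :=
  mul_nonneg (sub_nonneg.2 (pow_le_one₀ (by linarith) (by linarith))) (pow_nonneg (by linarith) _)

lemma frontierProb_le {p : ℝ} (h0 : 0 ≤ p) (h1 : p ≤ 1) (a y : ℕ) :
    frontierProb p a y ≤ a * p := by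
  have hb := one_add_mul_le_pow (a := -p) (by linarith) a
  have h2 : (1 - p) ^ y ≤ 1 := pow_le_one₀ (by linarith) (by linarith)
  have h3 : (1 - p) ^ a ≤ 1 := pow_le_one₀ (by linarith) (by linarith)
  have h4 : 0 ≤ (1 - p) ^ y := pow_nonneg (by linarith) _
  rw [← sub_eq_add_neg] at hb
  unfold frontierProb
  nlinarith

/-- The upper tail of the number of neighbours of `A`. -/
lemma integral_exp_card_frontier_le [DecidableEq V] (p : unitInterval) {t N : ℝ} (ht : 0 ≤ t)
    {A Y W : Finset V} (hAY : Disjoint A Y) (hAW : Disjoint A W) (hYW : Disjoint Y W)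
    (hW : (W.card : ℝ) ≤ N) :
    ∫ G, Real.exp (t * (frontier G A Y W).card) ∂(SimpleGraph.binomialRandom V p) ≤
      Real.exp ((Real.exp t - 1) * (N * p) * A.card) := by
  rw [integral_exp_card_frontier p t hAY hAW hYW]
  have hq := frontierProb_le p.2.1 p.2.2 A.card Y.card
  have hq0 := frontierProb_nonneg p.2.1 p.2.2 A.card Y.card
  have ht' : 0 ≤ Real.exp t - 1 := sub_nonneg.2 (Real.one_le_exp ht)
  have hp := p.2.1
  calc (1 + (Real.exp t - 1) * frontierProb p A.card Y.card) ^ W.card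
      ≤ Real.exp ((Real.exp t - 1) * frontierProb p A.card Y.card) ^ W.card := by
        refine pow_le_pow_left₀ (by positivity) ?_ _
        linarith [Real.add_one_le_exp ((Real.exp t - 1) * frontierProb p A.card Y.card)]
    _ = Real.exp (W.card * ((Real.exp t - 1) * frontierProb p A.card Y.card)) := by
        rw [← Real.exp_nat_mul]
    _ ≤ Real.exp ((Real.exp t - 1) * (N * p) * A.card) := by
        refine Real.exp_le_exp.2 ?_
        calc (W.card : ℝ) * ((Real.exp t - 1) * frontierProb p A.card Y.card)
            ≤ N * ((Real.exp t - 1) * (A.card * p)) := by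
              have hN : 0 ≤ N := (Nat.cast_nonneg _).trans hW
              gcongr
          _ = _ := by ring

/-- The product (1 - x + x²/2)(1 + x + x²/2) equals 1 + x⁴/4. -/
lemma exp_neg_le_quadratic {x : ℝ} (hx : 0 ≤ x) : Real.exp (-x) ≤ 1 - x + x ^ 2 / 2 := by
  have h := Real.quadratic_le_exp_of_nonneg hx
  have h0 : 0 < 1 + x + x ^ 2 / 2 := by positivity
  rw [Real.exp_neg]
  calc (Real.exp x)⁻¹ ≤ (1 + x + x ^ 2 / 2)⁻¹ := by gcongr
    _ ≤ 1 - x + x ^ 2 / 2 := by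
      rw [inv_le_iff_one_le_mul₀ h0]
      nlinarith [sq_nonneg (x ^ 2)]

/-- The lower tail of the size of the frontier. -/
lemma integral_card_frontier_lt_le [DecidableEq V] (p : unitInterval) {δ μ : ℝ} (hδ : 0 ≤ δ)
    (hδ2 : δ ≤ 1) {A Y W : Finset V} (hAY : Disjoint A Y) (hAW : Disjoint A W) (hYW : Disjoint Y W)
    (hμ : μ ≤ W.card * frontierProb p A.card Y.card) {m : ℕ}
    (hm : (m : ℝ) ≤ (1 - δ) * μ + 1) :
    ∫ G, ind ((frontier G A Y W).card < m) ∂(SimpleGraph.binomialRandom V p) ≤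
      Real.exp (-(δ ^ 2 * μ / 2)) := by
  have hq0 := frontierProb_nonneg p.2.1 p.2.2 A.card Y.card
  set q := frontierProb p A.card Y.card
  have he := exp_neg_le_quadratic hδ
  have he1 : 1 - δ ≤ Real.exp (-δ) := by linarith [Real.add_one_le_exp (-δ)]
  have hq1 : q ≤ 1 := by
    have h3 : 0 ≤ (1 - (p : ℝ)) ^ A.card := pow_nonneg (by linarith [p.2.2]) _
    have h4 : (1 - (p : ℝ)) ^ Y.card ≤ 1 :=
      pow_le_one₀ (by linarith [p.2.2]) (by linarith [p.2.1])
    have h5 : 0 ≤ (1 - (p : ℝ)) ^ Y.card := pow_nonneg (by linarith [p.2.2]) _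
    simp only [q, frontierProb]
    nlinarith
  -- Chernoff bound with parameter -δ. A size below `m` is at most `m - 1`, so the slack 1 in `hm`
  -- lets `m` be a ceiling.
  have h1 : ∀ G : SimpleGraph V, ind ((frontier G A Y W).card < m) ≤
      Real.exp (δ * ((1 - δ) * μ)) * Real.exp (-δ * (frontier G A Y W).card) := by
    intro G
    by_cases h : (frontier G A Y W).card < m
    · rw [ind_true h, ← Real.exp_add]
      refine Real.one_le_exp ?_
      have : ((frontier G A Y W).card : ℝ) + 1 ≤ m := by exact_mod_cast h
      nlinarith
    · rw [ind_false h]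
      positivity
  calc _ ≤ ∫ G, Real.exp (δ * ((1 - δ) * μ)) * Real.exp (-δ * (frontier G A Y W).card)
        ∂(SimpleGraph.binomialRandom V p) := integral_graph_mono p h1
    _ = Real.exp (δ * ((1 - δ) * μ)) * (1 + (Real.exp (-δ) - 1) * q) ^ W.card := by
        rw [integral_const_mul, integral_exp_card_frontier p _ hAY hAW hYW]
    _ ≤ Real.exp (δ * ((1 - δ) * μ)) * Real.exp (-(δ - δ ^ 2 / 2) * q) ^ W.card := by
        gcongr
        · nlinarith
        · have := Real.add_one_le_exp (-(δ - δ ^ 2 / 2) * q)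
          nlinarith
    _ = Real.exp (δ * ((1 - δ) * μ) - (δ - δ ^ 2 / 2) * (W.card * q)) := by
        rw [← Real.exp_nat_mul, ← Real.exp_add]
        ring_nf
    _ ≤ _ := by
        refine Real.exp_le_exp.2 ?_
        have : 0 ≤ δ - δ ^ 2 / 2 := by nlinarith
        nlinarith

end Frontier

/-! ### Breadth-first search from v and the number of vertices it finds -/

section Explore

variable {V : Type*} [Fintype V] [DecidableEq V]

/-- Breadth-first search from `v` in `G - u`: the current layer, and the set of the vertices not
yet discovered. -/
noncomputable def explore (u v : V) (G : SimpleGraph V) : ℕ → Finset V × Finset V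
  | 0 => ({v}, Finset.univ \ {u, v})
  | j + 1 =>
    (frontier G (explore u v G j).1 ∅ (explore u v G j).2,
      (explore u v G j).2 \ frontier G (explore u v G j).1 ∅ (explore u v G j).2)

lemma explore_snd_succ_subset (u v : V) (G : SimpleGraph V) (j : ℕ) :
    (explore u v G (j + 1)).2 ⊆ (explore u v G j).2 := Finset.sdiff_subset

lemma explore_fst_succ_subset (u v : V) (G : SimpleGraph V) (j : ℕ) :
    (explore u v G (j + 1)).1 ⊆ (explore u v G j).2 := frontier_subset _ _ _ _

lemma explore_disjoint (u v : V) (G : SimpleGraph V) (j : ℕ) :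
    Disjoint (explore u v G j).1 (explore u v G j).2 := by
  cases j with
  | zero => simp [explore]
  | succ j => exact Finset.disjoint_sdiff

lemma notMem_explore_snd (u v : V) (G : SimpleGraph V) (j : ℕ) : u ∉ (explore u v G j).2 := by
  induction j with
  | zero => simp [explore]
  | succ j ih => exact fun h => ih (explore_snd_succ_subset u v G j h)

lemma notMem_explore_fst {u v : V} (huv : u ≠ v) (G : SimpleGraph V) (j : ℕ) :
    u ∉ (explore u v G j).1 := by
  cases j with
  | zero => simpa [explore] using huv
  | succ j => exact fun h => notMem_explore_snd u v G j (explore_fst_succ_subset u v G j h)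

/-- The edges that are not revealed when the current layer is `x.1` and the set of undiscovered
vertices is `x.2`. -/
def unrevealed (u : V) (x : Finset V × Finset V) : Set (Sym2 V) :=
  edgesBetween (x.1 ∪ x.2 ∪ {u}) x.2

lemma unrevealed_succ_subset (u v : V) (G : SimpleGraph V) (j : ℕ) :
    unrevealed u (explore u v G (j + 1)) ⊆ unrevealed u (explore u v G j) := by
  refine edgesBetween_mono ?_ (explore_snd_succ_subset u v G j)
  refine Finset.union_subset_union (Finset.union_subset ?_ ?_) le_rfl
  · exact (explore_fst_succ_subset u v G j).trans Finset.subset_union_right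
  · exact (explore_snd_succ_subset u v G j).trans Finset.subset_union_right

/-- A round inspects only edges from the current layer to undiscovered vertices. Afterwards these
are no longer unrevealed: their endpoint in the old layer is neither in the new layer, nor
undiscovered, nor `u`. -/
lemma explore_congr {u v : V} (huv : u ≠ v) (G H : SimpleGraph V) (j : ℕ)
    (h : ∀ e ∈ (unrevealed u (explore u v G j))ᶜ, e ∈ G.edgeSet ↔ e ∈ H.edgeSet) :
    explore u v H j = explore u v G j := by
  induction j with
  | zero => rfl
  | succ j ih =>
    have ih' := ih fun e he => h e fun he' => he (unrevealed_succ_subset u v G j he')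
    have hf : frontier H (explore u v G j).1 ∅ (explore u v G j).2 =
        frontier G (explore u v G j).1 ∅ (explore u v G j).2 := by
      refine (dependsOnEdges_frontier _ _ _ G H fun e he => h e ?_).symm
      refine Set.disjoint_left.1 (disjoint_edgesBetween ?_ ?_) he
      · left
        rw [Finset.union_empty, Finset.disjoint_union_right, Finset.disjoint_union_right]
        refine ⟨⟨?_, ?_⟩, ?_⟩
        · exact Finset.disjoint_of_subset_right (explore_fst_succ_subset u v G j)
            (explore_disjoint u v G j)
        · exact Finset.disjoint_of_subset_right (explore_snd_succ_subset u v G j)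
            (explore_disjoint u v G j)
        · simpa using notMem_explore_fst huv G j
      · left
        rw [Finset.union_empty]
        exact Finset.disjoint_of_subset_right (explore_snd_succ_subset u v G j)
            (explore_disjoint u v G j)
    simp only [explore, ih', hf]

lemma dependsOnEdges_explore {u v : V} (huv : u ≠ v) (j : ℕ) (x : Finset V × Finset V) :
    DependsOnEdges (unrevealed u x)ᶜ fun G => explore u v G j = x := by
  intro G H h
  refine propext ⟨?_, ?_⟩
  · rintro rfl
    exact explore_congr huv G H j h
  · rintro rfl
    exact explore_congr huv H G j fun e he => (h e he).symm

/-- The number of vertices discovered in the first `j` rounds of the search. -/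
noncomputable def discovered (u v : V) (G : SimpleGraph V) (j : ℕ) : ℝ :=
  (Fintype.card V : ℝ) - 1 - (explore u v G j).2.card

lemma discovered_succ (u v : V) (G : SimpleGraph V) (j : ℕ) :
    discovered u v G (j + 1) = discovered u v G j + (explore u v G (j + 1)).1.card := by
  have := Finset.card_sdiff_add_card_eq_card (frontier_subset G (explore u v G j).1 ∅
    (explore u v G j).2)
  have h2 : (((explore u v G j).2.card : ℕ) : ℝ) =
      (explore u v G (j + 1)).2.card + (explore u v G (j + 1)).1.card := by
    rw [← this, Nat.cast_add]
    rfl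
  simp only [discovered, h2]
  ring

lemma discovered_zero {u v : V} (huv : u ≠ v) (G : SimpleGraph V) : discovered u v G 0 = 1 := by
  have h2 : ({u, v} : Finset V).card = 2 := Finset.card_pair huv
  have := Finset.card_sdiff_add_card_eq_card (Finset.subset_univ ({u, v} : Finset V))
  rw [Finset.card_univ, h2] at this
  simp only [discovered, explore, ← this]
  push_cast
  ring

lemma card_explore_fst_le (u v : V) (G : SimpleGraph V) (j : ℕ) (huv : u ≠ v) :
    ((explore u v G j).1.card : ℝ) ≤ discovered u v G j := by
  have hd : Disjoint ((explore u v G j).1 ∪ (explore u v G j).2) {u} := by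
    simp [notMem_explore_snd, notMem_explore_fst huv]
  have := Finset.card_le_univ (((explore u v G j).1 ∪ (explore u v G j).2) ∪ {u})
  rw [Finset.card_union_of_disjoint hd, Finset.card_union_of_disjoint (explore_disjoint u v G j),
    Finset.card_singleton] at this
  have h : (((explore u v G j).1.card : ℝ) + (explore u v G j).2.card) + 1 ≤ Fintype.card V := by
    exact_mod_cast this
  unfold discovered
  linarith

/-- Inverts exp(-h) ≥ 1 - h. The fractional linear bound makes the recursion for the exponents of
the search solvable in closed form. -/
lemma exp_sub_one_le {h : ℝ} (h1 : h < 1) : Real.exp h - 1 ≤ h / (1 - h) := by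
  have h2 := Real.add_one_le_exp (-h)
  have h3 : 0 < 1 - h := by linarith
  rw [le_div_iff₀ h3]
  have h4 : Real.exp h * Real.exp (-h) = 1 := by rw [← Real.exp_add]; simp
  nlinarith [Real.exp_pos h]

/-- The exponential moment of the search does not increase. -/
lemma integral_exp_explore_succ_le (p : unitInterval) {u v : V} (huv : u ≠ v) {α s s' : ℝ} (j : ℕ)
    (hs : 0 ≤ s) (h : (Real.exp s - 1) * ((Fintype.card V - 1) * p) ≤ s' - α) :
    ∫ G, Real.exp (α * discovered u v G (j + 1) + (s - α) * (explore u v G (j + 1)).1.card)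
        ∂(SimpleGraph.binomialRandom V p) ≤
      ∫ G, Real.exp (α * discovered u v G j + (s' - α) * (explore u v G j).1.card)
        ∂(SimpleGraph.binomialRandom V p) := by
  have key := integral_reveal_le p (fun G => explore u v G j)
    (fun x G => Real.exp (α * ((Fintype.card V : ℝ) - 1 - x.2.card)) *
      Real.exp (s * (frontier G x.1 ∅ x.2).card))
    (fun x => Real.exp (α * ((Fintype.card V : ℝ) - 1 - x.2.card)) *
      Real.exp ((s' - α) * x.1.card)) (unrevealed u)
    (dependsOnEdges_explore huv j) ?_ ?_
  · refine le_trans (le_of_eq ?_) (key.trans (le_of_eq ?_))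
    · congr 1
      ext G
      rw [discovered_succ, ← Real.exp_add]
      congr 1
      simp only [explore, discovered]
      ring
    · congr 1
      ext G
      rw [← Real.exp_add]
      rfl
  · intro x
    refine DependsOnEdges.mono ((dependsOnEdges_frontier x.1 ∅ x.2).comp fun S =>
      Real.exp (α * ((Fintype.card V : ℝ) - 1 - x.2.card)) * Real.exp (s * S.card)) ?_
    refine edgesBetween_mono ?_ le_rfl
    rw [Finset.union_empty, Finset.union_assoc]
    exact Finset.subset_union_left
  · intro G
    rw [integral_const_mul]
    refine mul_le_mul_of_nonneg_left ?_ (Real.exp_nonneg _)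
    refine (integral_exp_card_frontier_le p hs (Finset.disjoint_empty_right _)
      (explore_disjoint u v G j) (Finset.disjoint_empty_left _)
      (N := (Fintype.card V : ℝ) - 1) ?_).trans ?_
    · have := card_explore_fst_le u v G j huv
      unfold discovered at this
      have h0 : (0 : ℝ) ≤ (explore u v G j).1.card := Nat.cast_nonneg _
      linarith
    · exact Real.exp_le_exp.2 (mul_le_mul_of_nonneg_right h (Nat.cast_nonneg _))

/-- The number of vertices discovered in `k` rounds is at most twice its expectation, except with
exponentially small probability. -/
lemma integral_discovered_gt_le (p : unitInterval) {u v : V} (huv : u ≠ v) {d : ℝ}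
    (hd : d = (Fintype.card V - 1) * p) (hd0 : 0 < d) (k : ℕ) :
    ∫ G, ind (2 * (d + 1) ^ k < discovered u v G k) ∂(SimpleGraph.binomialRandom V p) ≤
      Real.exp (-(d / 6)) := by
  set D := d + 1 with hD
  have hD1 : 1 < D := by linarith
  have hpow : ∀ j, 1 ≤ D ^ j := fun j => one_le_pow₀ hD1.le
  -- Small enough that α ≤ s j / D for all j < k, and such that the threshold 2D^k gives the
  -- exponent α · 2D^k = d/2.
  set α := d / (4 * D ^ k) with hα
  have hα0 : 0 ≤ α := by positivity
  -- The solution of s(j+1) / (1 - s(j+1)) = s(j) / D with s(0) = d/3. Then d · s(j)/D = s(j) -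
  -- s(j)/D, which leaves room for α in every round.
  set s : ℕ → ℝ := fun j => d / (4 * D ^ j - 1) with hs
  have hsp : ∀ j, 0 < 4 * D ^ j - 1 := fun j => by linarith [hpow j]
  have hs0 : ∀ j, 0 ≤ s j := fun j => div_nonneg hd0.le (hsp j).le
  have step : ∀ j, j + 1 ≤ k → (Real.exp (s (j + 1)) - 1) * d ≤ s j - α := by
    intro j hj
    have hx := hpow j
    have hxk : D ^ j * D ≤ D ^ k := by
      rw [← pow_succ]
      exact pow_le_pow_right₀ hD1.le hj
    have e1 : 4 * D ^ (j + 1) - 1 = 4 * D ^ j * D - 1 := by ring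
    have hlt : s (j + 1) < 1 := by
      simp only [hs]
      rw [div_lt_one (hsp _), e1]
      nlinarith
    have h2 : s (j + 1) / (1 - s (j + 1)) = d / (D * (4 * D ^ j - 1)) := by
      have hne : D * (4 * D ^ j - 1) ≠ 0 := (mul_pos (by linarith) (hsp j)).ne'
      have hne2 := (hsp (j + 1)).ne'
      have h3 : 1 - s (j + 1) = D * (4 * D ^ j - 1) / (4 * D ^ (j + 1) - 1) := by
        simp only [hs]
        field_simp
        rw [hD]
        ring
      rw [h3]
      simp only [hs]
      field_simp
    have h4 : s j - d / (D * (4 * D ^ j - 1)) * d = s j / D := by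
      have := (hsp j).ne'
      have hD' : D ≠ 0 := by linarith
      simp only [hs]
      field_simp
      rw [hD]
      ring
    have h5 : α ≤ s j / D := by
      simp only [hs, hα]
      rw [div_div]
      exact div_le_div_of_nonneg_left hd0.le (mul_pos (hsp j) (by linarith)) (by nlinarith)
    have h6 := exp_sub_one_le hlt
    rw [h2] at h6
    nlinarith
  have main : ∀ j, j ≤ k →
      ∫ G, Real.exp (α * discovered u v G j + (s j - α) * (explore u v G j).1.card)
        ∂(SimpleGraph.binomialRandom V p) ≤ Real.exp (d / 3) := by
    intro j
    induction j with
    | zero =>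
      intro _
      simp_rw [discovered_zero huv]
      simp only [explore, Finset.card_singleton, hs]
      rw [integral_graph_const]
      refine Real.exp_le_exp.2 (le_of_eq ?_)
      norm_num
    | succ j ih =>
      intro hj
      refine (integral_exp_explore_succ_le p huv j (hs0 _) ?_).trans (ih (by omega))
      rw [← hd]
      exact step j hj
  have hsk : 0 ≤ s k - α := by
    rw [sub_nonneg]
    simp only [hs, hα]
    have := hsp k
    gcongr
    linarith
  have hpt : ∀ G : SimpleGraph V, ind (2 * D ^ k < discovered u v G k) ≤
      Real.exp (-(d / 2)) *
        Real.exp (α * discovered u v G k + (s k - α) * (explore u v G k).1.card) := by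
    intro G
    by_cases h : 2 * D ^ k < discovered u v G k
    · rw [ind_true h, ← Real.exp_add]
      refine Real.one_le_exp ?_
      have h1 : α * (2 * D ^ k) ≤ α * discovered u v G k := by gcongr
      have h2 : α * (2 * D ^ k) = d / 2 := by
        have := (hpow k)
        simp only [hα]
        field_simp
        norm_num
      have h3 : 0 ≤ (s k - α) * (explore u v G k).1.card := by positivity
      linarith
    · rw [ind_false h]
      positivity
  calc _ ≤ _ := integral_graph_mono p hpt
    _ = Real.exp (-(d / 2)) * _ := integral_const_mul _ _
    _ ≤ Real.exp (-(d / 2)) * Real.exp (d / 3) := by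
      gcongr
      exact main k le_rfl
    _ = Real.exp (-(d / 6)) := by
      rw [← Real.exp_add]
      ring_nf

end Explore

/-! ### Distances, and the vertices that rule out a pair -/

section Distance

variable {V : Type*}

lemma edist_le_edist_add_one_of_adj {G : SimpleGraph V} {a b : V} (h : G.Adj a b) (s : V) :
    G.edist s b ≤ G.edist s a + 1 := by
  refine (SimpleGraph.edist_triangle (v := a)).trans ?_
  rw [SimpleGraph.edist_eq_one_iff_adj.2 h]

lemma exists_adj_edist_add_one_le {G : SimpleGraph V} {v x : V} (hvx : v ≠ x)
    (h : G.edist v x ≠ ⊤) : ∃ y, G.Adj y x ∧ G.edist v y + 1 ≤ G.edist v x := by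
  obtain ⟨w, hw⟩ := SimpleGraph.exists_walk_of_edist_ne_top (G := G) (u := x) (v := v)
    (by rwa [SimpleGraph.edist_comm])
  cases w with
  | nil => exact absurd rfl hvx
  | @cons _ y _ hxy q =>
    refine ⟨y, hxy.symm, ?_⟩
    rw [SimpleGraph.edist_comm (u := v) (v := x), ← hw, SimpleGraph.Walk.length_cons, Nat.cast_add,
      SimpleGraph.edist_comm]
    exact add_le_add_left (SimpleGraph.edist_le q) _

/-- The vertices that rule out `{u, v}`. -/
def Distinguishes (G : SimpleGraph V) (u v s : V) : Prop :=
  ¬ (G.edist s u ≤ G.edist s v + 1 ∧ G.edist s v ≤ G.edist s u + 1)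

lemma two_le_edist {G : SimpleGraph V} {u v : V} (huv : u ≠ v) (hadj : ¬ G.Adj u v) :
    2 ≤ G.edist v u := by
  by_contra! h
  have h1 : G.edist v u ≤ 1 := by
    have : G.edist v u < 1 + 1 := by simpa [one_add_one_eq_two] using h
    exact ENat.lt_add_one_iff (by simp) |>.1 this
  rcases h1.lt_or_eq with h2 | h2
  · rw [Order.lt_one_iff, SimpleGraph.edist_eq_zero_iff] at h2
    exact huv h2.symm
  · exact hadj (SimpleGraph.edist_eq_one_iff_adj.1 h2).symm

/-- Finiteness of the distance to `u` permits cancelling it in `ℕ∞`; the distance to `v` may be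
infinite. -/
lemma distinguishes_of_add_two_le {G : SimpleGraph V} {u v s : V} (h : G.edist u s ≠ ⊤)
    (h2 : G.edist u s + 2 ≤ G.edist v s) : Distinguishes G u v s := by
  rintro ⟨-, h3⟩
  rw [SimpleGraph.edist_comm (u := s) (v := v), SimpleGraph.edist_comm (u := s) (v := u)] at h3
  have h4 := h2.trans h3
  rw [ENat.add_le_add_iff_left h] at h4
  exact absurd h4 (by decide)

lemma distinguishes_self {G : SimpleGraph V} {u v : V} (huv : u ≠ v) (hadj : ¬ G.Adj u v) :
    Distinguishes G u v u :=
  distinguishes_of_add_two_le (by simp) (by simpa using two_le_edist huv hadj)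

lemma edist_le_of_mem_frontier {G : SimpleGraph V} {A Y W : Finset V} {u s : V} {i : ℕ}
    (hA : ∀ a ∈ A, G.edist u a ≤ i) (hs : s ∈ frontier G A Y W) : G.edist u s ≤ (i + 1 : ℕ) := by
  obtain ⟨_, ⟨a, ha, has⟩, _⟩ := mem_frontier.1 hs
  refine (edist_le_edist_add_one_of_adj has u).trans ?_
  push_cast
  gcongr
  exact hA a ha

variable [Fintype V] [DecidableEq V]

/-- Once a layer has been processed, all its neighbours are discovered. The vertex `u` is exempt
because the search never enters it. -/
lemma explore_not_adj {u v : V} (G : SimpleGraph V) (j : ℕ) {x y : V}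
    (hy : y ∉ (explore u v G j).2) (hy' : y ∉ (explore u v G j).1) (hyu : y ≠ u)
    (hx : x ∈ (explore u v G j).2) : ¬ G.Adj y x := by
  induction j with
  | zero =>
    simp only [explore, Finset.mem_sdiff, Finset.mem_univ, true_and, Finset.mem_insert,
      Finset.mem_singleton] at hy hy'
    tauto
  | succ j ih =>
    intro hadj
    have hx1 := explore_snd_succ_subset u v G j hx
    have hyW : y ∉ (explore u v G j).2 := by
      intro h
      simp only [explore, Finset.mem_sdiff, not_and, not_not] at hy hy'
      exact hy' (hy h)
    by_cases hyA : y ∈ (explore u v G j).1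
    · refine (Finset.mem_sdiff.1 hx).2 (mem_frontier.2 ⟨hx1, ⟨y, hyA, hadj⟩, by simp⟩)
    · exact ih hyW hyA hx1 hadj

/-- A shortest path from `v` to a vertex that the search in `G - u` did not find in `j` rounds is
longer than `j`, or passes through `u`. -/
lemma edist_through_of_mem_explore {u v : V} (G : SimpleGraph V) (j : ℕ) {x : V}
    (hx : x ∈ (explore u v G j).2) (hd : G.edist v x ≤ j) :
    G.edist v u + G.edist u x ≤ G.edist v x := by
  induction j generalizing x with
  | zero =>
    rw [Nat.cast_zero, nonpos_iff_eq_zero, SimpleGraph.edist_eq_zero_iff] at hd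
    simp [explore, hd] at hx
  | succ j ih =>
    have hvx : v ≠ x := by
      rintro rfl
      have : v ∈ (explore u v G 0).2 :=
        antitone_nat_of_succ_le (f := fun j => (explore u v G j).2)
          (explore_snd_succ_subset u v G) (Nat.zero_le _) hx
      simp [explore] at this
    -- The predecessor `y` of `x` on a shortest path is either `u` or itself undiscovered one round
    -- earlier, where induction applies.
    obtain ⟨y, hyx, hy⟩ := exists_adj_edist_add_one_le hvx (hd.trans_lt (ENat.natCast_lt_top _)).ne
    by_cases hyu : y = u
    · subst hyu
      rwa [SimpleGraph.edist_eq_one_iff_adj.2 hyx]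
    · have hx1 := explore_snd_succ_subset u v G j hx
      have hyW : y ∈ (explore u v G j).2 := by
        by_contra hyW
        by_cases hyA : y ∈ (explore u v G j).1
        · exact (Finset.mem_sdiff.1 hx).2 (mem_frontier.2 ⟨hx1, ⟨y, hyA, hyx⟩, by simp⟩)
        · exact explore_not_adj G j hyW hyA hyu hx1 hyx
      have hyd : G.edist v y ≤ j := by
        have := hy.trans hd
        push_cast at this
        exact (ENat.add_le_add_iff_right (by simp)).1 this
      calc G.edist v u + G.edist u x ≤ G.edist v u + (G.edist u y + 1) := by
            gcongr
            exact edist_le_edist_add_one_of_adj hyx u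
        _ = G.edist v u + G.edist u y + 1 := by ring
        _ ≤ G.edist v y + 1 := by
            gcongr
            exact ih hyW hyd
        _ ≤ _ := hy

end Distance

/-! ### Growing layers from u outside the explored part -/

section Grow

variable {V : Type*} [DecidableEq V]

/-- From the layer `A` (number `i`), one can grow `j` more layers of sizes prescribed by `m` inside
`W`, and then a last layer with at least `r` vertices without neighbours in `Y`. -/
def Grows (G : SimpleGraph V) (Y : Finset V) (m : ℕ → ℕ) (r : ℕ) :
    ℕ → ℕ → Finset V → Finset V → Prop
  | 0, _, A, W => r ≤ (frontier G A Y W).card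
  | j + 1, i, A, W =>
    ∃ B ⊆ frontier G A ∅ W, B.card = m (i + 1) ∧ Grows G Y m r j (i + 1) B (W \ B)

lemma Grows.exists_finset {G : SimpleGraph V} {Y : Finset V} {m : ℕ → ℕ} {r : ℕ} {u : V} {j i : ℕ}
    {A W : Finset V} (h : Grows G Y m r j i A W) (hA : ∀ a ∈ A, G.edist u a ≤ i) :
    ∃ T ⊆ W, r ≤ T.card ∧ ∀ s ∈ T, G.edist u s ≤ (i + j + 1 : ℕ) ∧ ∀ y ∈ Y, ¬ G.Adj y s := by
  induction j generalizing i A W with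
  | zero =>
    exact ⟨_, frontier_subset _ _ _ _, h,
      fun s hs => ⟨edist_le_of_mem_frontier hA hs, (mem_frontier.1 hs).2.2⟩⟩
  | succ j ih =>
    obtain ⟨B, hB, -, hG⟩ := h
    obtain ⟨T, hT, hr, hT'⟩ := ih hG fun b hb => edist_le_of_mem_frontier hA (hB hb)
    refine ⟨T, hT.trans Finset.sdiff_subset, hr, fun s hs => ?_⟩
    have := hT' s hs
    rwa [show i + 1 + j + 1 = i + (j + 1) + 1 by ring] at this

lemma dependsOnEdges_grows (Y : Finset V) (m : ℕ → ℕ) (r j i : ℕ) (A W : Finset V) :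
    DependsOnEdges (edgesBetween (A ∪ W ∪ Y) W) fun G => Grows G Y m r j i A W := by
  induction j generalizing i A W with
  | zero =>
    refine ((dependsOnEdges_frontier A Y W).comp fun S => r ≤ S.card).mono ?_
    exact edgesBetween_mono (Finset.union_subset_union Finset.subset_union_left le_rfl) le_rfl
  | succ j ih =>
    intro G H h
    have h1 : frontier G A ∅ W = frontier H A ∅ W :=
      dependsOnEdges_frontier A ∅ W G H fun e he => h e (edgesBetween_mono
        (by rw [Finset.union_empty, Finset.union_assoc]; exact Finset.subset_union_left) le_rfl he)
    simp only [Grows, h1]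
    refine propext (exists_congr fun B => and_congr_right fun hB => and_congr_right fun _ => ?_)
    refine (ih (i + 1) B (W \ B) G H fun e he => h e ?_).to_iff
    refine edgesBetween_mono (Finset.union_subset_union ?_ le_rfl) Finset.sdiff_subset he
    exact (Finset.union_subset (hB.trans (frontier_subset _ _ _ _)) Finset.sdiff_subset).trans
      Finset.subset_union_right

variable [Fintype V]

/-- A union bound over the layers. -/
lemma integral_not_grows_le (p : unitInterval) {Y : Finset V} {m : ℕ → ℕ} {r K : ℕ} {N : ℕ} {η : ℝ}
    (hstep : ∀ i < K, ∀ A W : Finset V, Disjoint A W → A.card = m i → N ≤ W.card →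
      ∫ G, ind ((frontier G A ∅ W).card < m (i + 1)) ∂(SimpleGraph.binomialRandom V p) ≤ η)
    (hlast : ∀ A W : Finset V, Disjoint A W → Disjoint A Y → Disjoint Y W → A.card = m K →
      N ≤ W.card → ∫ G, ind ((frontier G A Y W).card < r) ∂(SimpleGraph.binomialRandom V p) ≤ η)
    (j i : ℕ) (hij : i + j = K) (A W : Finset V) (hA : A.card = m i) (hAW : Disjoint A W)
    (hAY : Disjoint A Y) (hYW : Disjoint Y W)
    (hW : N + ∑ l ∈ Finset.range j, m (i + 1 + l) ≤ W.card) :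
    ∫ G, ind (¬ Grows G Y m r j i A W) ∂(SimpleGraph.binomialRandom V p) ≤ (j + 1) * η := by
  induction j generalizing i A W with
  | zero =>
    obtain rfl : i = K := by simpa using hij
    simp only [Grows, not_le, Nat.cast_zero, zero_add, one_mul]
    exact hlast A W hAW hAY hYW hA (by simpa using hW)
  | succ j ih =>
    -- The next layer is trimmed to a prescribed size by a choice that depends only on the revealed
    -- frontier.
    have hB : ∀ x : Finset V, ∃ B : Finset V, m (i + 1) ≤ x.card → B ⊆ x ∧ B.card = m (i + 1) := by
      intro x
      by_cases hx : m (i + 1) ≤ x.card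
      · obtain ⟨B, hB⟩ := Finset.exists_subset_card_eq hx
        exact ⟨B, fun _ => hB⟩
      · exact ⟨∅, fun h => absurd h hx⟩
    choose B hB using hB
    have hsum : m (i + 1) + ∑ l ∈ Finset.range j, m (i + 1 + 1 + l) =
        ∑ l ∈ Finset.range (j + 1), m (i + 1 + l) := by
      rw [Finset.sum_range_succ', add_comm, add_zero]
      congr 1
      exact Finset.sum_congr rfl fun l _ => by ring_nf
    -- The frontier is decided by edges from `A` to `W` alone. Edges between `Y` and `W` stay
    -- unrevealed until the last layer.
    have key := integral_reveal_le p (fun G => frontier G A ∅ W)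
      (fun x G => ind (x.card < m (i + 1)) + ind ((m (i + 1) ≤ x.card ∧ x ⊆ W) ∧
        ¬ Grows G Y m r j (i + 1) (B x) (W \ B x)))
      (fun x => ind (x.card < m (i + 1)) + (j + 1) * η) (fun _ => edgesBetween (W ∪ Y) W) ?_ ?_ ?_
    · calc _ ≤ _ := integral_graph_mono p ?_
        _ ≤ _ := key
        _ ≤ _ := ?_
      · intro G
        by_cases h : m (i + 1) ≤ (frontier G A ∅ W).card
        · rw [ind_false (not_lt.2 h), zero_add]
          refine ind_mono fun hG => ⟨⟨h, frontier_subset _ _ _ _⟩, fun hG' => hG ?_⟩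
          exact ⟨_, (hB _ h).1, (hB _ h).2, hG'⟩
        · rw [ind_true (not_le.1 h)]
          linarith [ind_le_one (¬ Grows G Y m r (j + 1) i A W), ind_nonneg
            ((m (i + 1) ≤ (frontier G A ∅ W).card ∧ frontier G A ∅ W ⊆ W) ∧
              ¬ Grows G Y m r j (i + 1) (B (frontier G A ∅ W)) (W \ B (frontier G A ∅ W)))]
      · rw [integral_add (integrable_graph p _) (integrable_graph p _), integral_graph_const]
        have := hstep i (by omega) A W hAW hA (by omega)
        push_cast
        linarith
    · intro x
      refine ((dependsOnEdges_frontier A ∅ W).comp fun S => S = x).mono ?_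
      rw [Set.subset_compl_iff_disjoint_right, Finset.union_empty]
      exact disjoint_edgesBetween (.inl (Finset.disjoint_union_right.2 ⟨hAW, hAY⟩)) (.inl hAW)
    · intro x
      by_cases hx : m (i + 1) ≤ x.card ∧ x ⊆ W
      · refine ((dependsOnEdges_grows Y m r j (i + 1) (B x) (W \ B x)).comp fun q =>
          ind (x.card < m (i + 1)) + ind ((m (i + 1) ≤ x.card ∧ x ⊆ W) ∧ ¬ q)).mono ?_
        refine edgesBetween_mono (Finset.union_subset_union ?_ le_rfl) Finset.sdiff_subset
        exact Finset.union_subset ((hB x hx.1).1.trans hx.2) Finset.sdiff_subset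
      · intro G H _
        simp only [hx, false_and]
    · intro G
      rw [integral_add (integrable_graph p _) (integrable_graph p _), integral_graph_const]
      refine add_le_add le_rfl ?_
      set x := frontier G A ∅ W with hx
      by_cases hc : m (i + 1) ≤ x.card
      · have hxW : x ⊆ W := frontier_subset _ _ _ _
        have hBW := (hB x hc).1.trans hxW
        refine (integral_graph_mono p fun H => ind_mono And.right).trans ?_
        refine ih (i + 1) (by omega) (B x) (W \ B x) (hB x hc).2 Finset.disjoint_sdiff ?_ ?_ ?_
        · exact Finset.disjoint_of_subset_left hBW hYW.symm
        · exact Finset.disjoint_of_subset_right Finset.sdiff_subset hYW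
        · have := Finset.card_sdiff_add_card_eq_card hBW
          rw [(hB x hc).2] at this
          omega
      · have h0 : 0 ≤ η := (integral_nonneg fun G => ind_nonneg _).trans
          (hstep i (by omega) A W hAW hA (by omega))
        simp only [hc, false_and, ind_false not_false]
        rw [integral_graph_const]
        positivity

open Classical in
/-- If the search from `u` succeeds outside the part explored from `v`, then many vertices rule out
the non-edge `{u, v}`. -/
lemma Grows.le_card_distinguishes {G : SimpleGraph V} {u v : V} (huv : u ≠ v) (hadj : ¬ G.Adj u v)
    {m : ℕ → ℕ} {r k : ℕ}
    (h : Grows G (explore u v G (k + 1)).1 m r k 0 {u} (explore u v G (k + 1)).2) :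
    r ≤ (Finset.univ.filter fun s => Distinguishes G u v s).card := by
  obtain ⟨T, hT, hr, hT'⟩ := h.exists_finset (u := u) (by simp)
  refine hr.trans (Finset.card_le_card fun s hs => ?_)
  obtain ⟨h1, h2⟩ := hT' s hs
  rw [zero_add] at h1
  refine Finset.mem_filter.2 ⟨Finset.mem_univ _, distinguishes_of_add_two_le
    (h1.trans_lt (ENat.natCast_lt_top _)).ne ?_⟩
  -- Undiscovered after k + 1 rounds and without neighbours in the layer reached then, `s` is missed
  -- by one further round: this gains the step needed for a gap of two.
  have hs' : s ∈ (explore u v G (k + 2)).2 := by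
    refine Finset.mem_sdiff.2 ⟨hT hs, fun h => ?_⟩
    obtain ⟨-, ⟨a, ha, has⟩, -⟩ := mem_frontier.1 h
    exact h2 a ha has
  by_cases hd : G.edist v s ≤ (k + 2 : ℕ)
  · refine le_trans ?_ (edist_through_of_mem_explore G (k + 2) hs' hd)
    rw [add_comm]
    gcongr
    exact two_le_edist huv hadj
  · have h3 : ((k + 2 : ℕ) : ℕ∞) + 1 ≤ G.edist v s := Order.add_one_le_of_lt (not_le.1 hd)
    refine le_trans ?_ h3
    calc G.edist u s + 2 ≤ ((k + 1 : ℕ) : ℕ∞) + 2 := by gcongr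
      _ = _ := by push_cast; ring

open Classical in
/-- The probability that a non-edge is ruled out by few vertices. -/
lemma integral_few_distinguishing_le (p : unitInterval) {u v : V} (huv : u ≠ v) {m : ℕ → ℕ}
    {r k : ℕ} {N : ℕ} {η d : ℝ} (hd : d = (Fintype.card V - 1) * p) (hd0 : 0 < d)
    (hstep : ∀ i < k, ∀ A W : Finset V, Disjoint A W → A.card = m i → N ≤ W.card →
      ∫ G, ind ((frontier G A ∅ W).card < m (i + 1)) ∂(SimpleGraph.binomialRandom V p) ≤ η)
    (hlast : ∀ A Y W : Finset V, Disjoint A W → Disjoint A Y → Disjoint Y W → A.card = m k →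
      N ≤ W.card → (Y.card : ℝ) ≤ 2 * (d + 1) ^ (k + 1) →
      ∫ G, ind ((frontier G A Y W).card < r) ∂(SimpleGraph.binomialRandom V p) ≤ η)
    (hη : 0 ≤ η) (hm : m 0 = 1)
    (hN : (N : ℝ) + ∑ l ∈ Finset.range k, (m (l + 1) : ℝ) + 2 * (d + 1) ^ (k + 1) + 1 ≤
      Fintype.card V) :
    ∫ G, ind (¬ G.Adj u v ∧ (Finset.univ.filter fun s => Distinguishes G u v s).card < r)
      ∂(SimpleGraph.binomialRandom V p) ≤ Real.exp (-(d / 6)) + (k + 1) * η := by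
  -- The size bound is part of the event, so only explorations that leave enough room for the layers
  -- from `u` have to be considered.
  have key := integral_reveal_le p (fun G => explore u v G (k + 1))
    (fun x G => ind ((Fintype.card V : ℝ) - 1 - x.2.card ≤ 2 * (d + 1) ^ (k + 1) ∧
      ¬ Grows G x.1 m r k 0 {u} x.2)) (fun _ => (k + 1) * η) (unrevealed u)
    (dependsOnEdges_explore huv (k + 1)) ?_ ?_
  · rw [integral_graph_const] at key
    refine le_trans ?_ (add_le_add (integral_discovered_gt_le p huv hd hd0 (k + 1)) key)
    rw [← integral_add (integrable_graph p _) (integrable_graph p _)]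
    refine integral_graph_mono p fun G => le_trans (ind_mono ?_) (ind_or_le _ _)
    rintro ⟨h1, h2⟩
    by_cases h3 : 2 * (d + 1) ^ (k + 1) < discovered u v G (k + 1)
    · exact .inl h3
    · exact .inr ⟨not_lt.1 h3, fun h => h2.not_ge (h.le_card_distinguishes huv h1)⟩
  · intro x
    refine ((dependsOnEdges_grows x.1 m r k 0 {u} x.2).comp fun q =>
      ind ((Fintype.card V : ℝ) - 1 - x.2.card ≤ 2 * (d + 1) ^ (k + 1) ∧ ¬ q)).mono ?_
    refine edgesBetween_mono ?_ le_rfl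
    intro y
    simp only [Finset.mem_union]
    tauto
  · intro G
    set x := explore u v G (k + 1) with hx
    by_cases hc : (Fintype.card V : ℝ) - 1 - x.2.card ≤ 2 * (d + 1) ^ (k + 1)
    · refine (integral_graph_mono p fun H => ind_mono And.right).trans ?_
      refine integral_not_grows_le p hstep ?_ k 0 (by simp) {u} x.2 (by simp [hm]) ?_ ?_
        (explore_disjoint u v G _) ?_
      · intro A W h1 h2 h3 h4 h5
        exact hlast A x.1 W h1 h2 h3 h4 h5
          ((card_explore_fst_le u v G (k + 1) huv).trans hc)
      · simpa using notMem_explore_snd u v G (k + 1)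
      · simpa using notMem_explore_fst huv G (k + 1)
      · have : ((N + ∑ l ∈ Finset.range k, m (0 + 1 + l) : ℕ) : ℝ) ≤ x.2.card := by
          push_cast
          have h6 : ∀ l, 0 + 1 + l = l + 1 := fun l => by ring
          simp only [h6]
          linarith
        exact_mod_cast this
    · simp only [hc, false_and, ind_false not_false]
      rw [integral_graph_const]
      positivity

end Grow

/-! ### Numerical estimates for the layer sizes -/

section Numeric

/-- Sizes of the layers that the search from `u` is required to reach. -/
noncomputable def layerSize (d : ℝ) : ℕ → ℕ
  | 0 => 1
  | i + 1 => ⌈(1 - (1 / 2) ^ i / 8) * ((d - 6) * layerSize d i)⌉₊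

lemma half_pow_div_mem (i : ℕ) : 0 ≤ (1 / 2 : ℝ) ^ i / 8 ∧ (1 / 2 : ℝ) ^ i / 8 ≤ 1 / 8 := by
  have h1 : (1 / 2 : ℝ) ^ i ≤ 1 := pow_le_one₀ (by norm_num) (by norm_num)
  have h2 : 0 ≤ (1 / 2 : ℝ) ^ i := by positivity
  constructor <;> linarith

lemma one_le_layerSize {d : ℝ} (hd : 10 ≤ d) (i : ℕ) : 1 ≤ layerSize d i := by
  induction i with
  | zero => exact le_rfl
  | succ i ih =>
    have h := half_pow_div_mem i
    have h1 : (1 : ℝ) ≤ layerSize d i := by exact_mod_cast ih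
    refine Nat.one_le_ceil_iff.2 (mul_pos (by linarith) (mul_pos (by linarith) (by linarith)))

/-- Rounding up costs less than 1, which the loss of 6 new vertices per vertex of the layer absorbs.
-/
lemma layerSize_le {d : ℝ} (hd : 10 ≤ d) (i : ℕ) : (layerSize d i : ℝ) ≤ d ^ i := by
  induction i with
  | zero => simp [layerSize]
  | succ i ih =>
    have h := half_pow_div_mem i
    have h1 : (1 : ℝ) ≤ layerSize d i := by exact_mod_cast one_le_layerSize hd i
    have h2 : 0 ≤ (d - 6) * layerSize d i := mul_nonneg (by linarith) (by linarith)
    have h3 := (Nat.ceil_lt_add_one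
      (mul_nonneg (by linarith : (0 : ℝ) ≤ 1 - (1 / 2) ^ i / 8) h2)).le
    have h4 : d * layerSize d i ≤ d * d ^ i := by gcongr
    rw [pow_succ']
    refine (show (layerSize d (i + 1) : ℝ) ≤ _ from h3).trans ?_
    nlinarith

/-- The deviations 2^(-l)/8 for l < i sum to (1 - 2^(-i))/4, and replacing d by d - 6 costs a
relative 6/d per layer. So a constant fraction of d^i remains as long as i is small against d. -/
lemma le_layerSize {d : ℝ} (hd : 10 ≤ d) (i : ℕ) :
    (1 - (1 - (1 / 2) ^ i) / 4 - 6 * i / d) * d ^ i ≤ layerSize d i := by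
  induction i with
  | zero => simp [layerSize]
  | succ i ih =>
    have h := half_pow_div_mem i
    have hd0 : 0 < d := by linarith
    have h6 : 0 ≤ 6 * i / d := by positivity
    have hle : (1 - (1 - (1 / 2) ^ i) / 4 - 6 * i / d : ℝ) ≤ 1 := by
      have : (1 / 2 : ℝ) ^ i ≤ 1 := pow_le_one₀ (by norm_num) (by norm_num)
      linarith
    set θ : ℝ := 1 - (1 - (1 / 2) ^ i) / 4 - 6 * i / d with hθ
    set δ : ℝ := (1 / 2) ^ i / 8 with hδ
    have hsucc : (1 - (1 - (1 / 2) ^ (i + 1)) / 4 - 6 * ((i + 1 : ℕ) : ℝ) / d : ℝ) =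
        θ - δ - 6 / d := by
      simp only [hθ, hδ]
      rw [pow_succ]
      push_cast
      ring
    rw [hsucc]
    have hpos : 0 < d ^ i := by positivity
    calc (θ - δ - 6 / d) * d ^ (i + 1) ≤ (1 - δ) * ((d - 6) * (θ * d ^ i)) := by
          have e1 : (θ - δ - 6 / d) * d ^ (i + 1) = ((θ - δ) * d - 6) * d ^ i := by
            rw [pow_succ]
            field_simp
          have e2 : (1 - δ) * ((d - 6) * (θ * d ^ i)) = ((1 - δ) * (d - 6) * θ) * d ^ i := by ring
          rw [e1, e2]
          refine mul_le_mul_of_nonneg_right ?_ hpos.le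
          have h7 : 0 ≤ (1 - θ) * (δ * d) := mul_nonneg (by linarith) (mul_nonneg h.1 hd0.le)
          by_cases hθ0 : 0 ≤ θ
          · have h8 : 0 ≤ δ * θ := mul_nonneg h.1 hθ0
            nlinarith
          · have h9 : (1 - δ) * θ ≥ θ - δ := by nlinarith
            have h10 : 0 ≤ (-θ) * (1 - δ) := mul_nonneg (by linarith) (by linarith)
            nlinarith
      _ ≤ (1 - δ) * ((d - 6) * layerSize d i) := by
          refine mul_le_mul_of_nonneg_left ?_ (by linarith)
          exact mul_le_mul_of_nonneg_left ih (by linarith)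
      _ ≤ layerSize d (i + 1) := Nat.le_ceil _

lemma sum_layerSize_le {d : ℝ} (hd : 10 ≤ d) (k : ℕ) :
    ∑ l ∈ Finset.range k, (layerSize d (l + 1) : ℝ) + 1 ≤ (d + 1) ^ (k + 1) := by
  induction k with
  | zero => simp; linarith
  | succ k ih =>
    rw [Finset.sum_range_succ]
    have h1 := layerSize_le hd (k + 1)
    have h2 : d ^ (k + 1) ≤ (d + 1) ^ (k + 1) :=
      pow_le_pow_left₀ (by linarith) (by linarith) _
    have h3 : 0 ≤ (d + 1) ^ (k + 1) := by positivity
    rw [pow_succ _ (k + 1)]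
    nlinarith

lemma frontierProb_ge {p : ℝ} (h0 : 0 ≤ p) (h1 : p ≤ 1) (a y : ℕ) :
    a * p * (1 - a * p / 2) * (1 - p) ^ y ≤ frontierProb p a y := by
  refine mul_le_mul_of_nonneg_right ?_ (pow_nonneg (by linarith) _)
  have h2 : (1 - p) ^ a ≤ Real.exp (-(a * p)) := by
    calc (1 - p) ^ a ≤ Real.exp (-p) ^ a :=
          pow_le_pow_left₀ (by linarith) (by linarith [Real.add_one_le_exp (-p)]) _
      _ = Real.exp (-(a * p)) := by rw [← Real.exp_nat_mul]; ring_nf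
  have h3 := exp_neg_le_quadratic (x := a * p) (by positivity)
  nlinarith

lemma exp_neg_two_mul_le_one_sub_pow {p : ℝ} (h0 : 0 ≤ p) (h1 : p ≤ 1 / 2) (y : ℕ) :
    Real.exp (-(2 * (p * y))) ≤ (1 - p) ^ y := by
  have h2 : Real.exp (-(2 * p)) ≤ 1 - p := by
    have := exp_neg_le_quadratic (x := 2 * p) (by linarith)
    nlinarith
  calc Real.exp (-(2 * (p * y))) = Real.exp (-(2 * p)) ^ y := by
        rw [← Real.exp_nat_mul]; ring_nf
    _ ≤ (1 - p) ^ y := pow_le_pow_left₀ (Real.exp_nonneg _) h2 _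

lemma exp_neg_four_ge : (1 / 60 : ℝ) ≤ Real.exp (-4) := by
  have h : Real.exp (-4) = (Real.exp 1 ^ 4)⁻¹ := by
    rw [← Real.exp_nat_mul, ← Real.exp_neg]
    norm_num
  rw [h, one_div]
  have h2 : Real.exp 1 ^ 4 ≤ 2.72 ^ 4 :=
    pow_le_pow_left₀ (Real.exp_nonneg _) (by linarith [Real.exp_one_lt_d9]) _
  have h3 : 0 < Real.exp 1 ^ 4 := by positivity
  gcongr
  exact h2.trans (by norm_num)

/-- A lower bound for the expected number of new vertices next to a layer of size `a`. -/
lemma frontier_mean_ge {n a y N w : ℕ} {p d : ℝ} (hp0 : 0 ≤ p) (hp1 : p ≤ 1)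
    (hd : d = ((n : ℝ) - 1) * p) (hd10 : 10 ≤ d) (hdn : d + 1 ≤ n) (ha : a * (d * (d + 1)) ≤ n)
    (hN : (n : ℝ) - 3 * n / (d + 1) ≤ N + 1) (hw : N ≤ w) :
    (d - 6) * a * (1 - p) ^ y ≤ w * frontierProb p a y := by
  set D := d + 1 with hD
  have hD0 : 0 < D := by linarith
  have hn0 : (0 : ℝ) < n := by linarith
  have hρ : 0 ≤ (1 - p) ^ y := pow_nonneg (by linarith) _
  -- Three parts n/D are used by the two searches; a fourth absorbs the rounding of `N`.
  have hw' : n * (1 - 4 / D) ≤ w := by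
    have h1 : (N : ℝ) ≤ w := by exact_mod_cast hw
    have h2 : 1 ≤ n / D := (one_le_div hD0).2 hdn
    have h3 : n * (1 - 4 / D) = n - 3 * n / D - n / D := by ring
    linarith
  have hap : a * p ≤ 2 / D := by
    rw [le_div_iff₀ hD0]
    have h1 : ((n : ℝ) - 1) * (a * p * D) ≤ ((n : ℝ) - 1) * 2 := by
      have : ((n : ℝ) - 1) * (a * p * D) = a * (d * D) := by rw [hd]; ring
      rw [this]
      linarith
    exact le_of_mul_le_mul_left h1 (by linarith)
  have hap0 : 0 ≤ a * p := by positivity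
  have h4 : 0 ≤ 1 - 4 / D := by
    rw [sub_nonneg, div_le_one hD0]
    linarith
  have h1D : 0 ≤ 1 / D := by positivity
  have e4 : 4 / D = 4 * (1 / D) := by ring
  have e2 : 2 / D = 2 * (1 / D) := by ring
  have hdD : d * (1 / D) ≤ 1 := by
    rw [mul_one_div, div_le_one hD0]
    linarith
  rw [e4] at hw' h4
  rw [e2] at hap
  set z := 1 / D
  calc (d - 6) * a * (1 - p) ^ y
      ≤ (n * (1 - 4 * z)) * (a * p * (1 - a * p / 2) * (1 - p) ^ y) := by
        have e5 : (n * (1 - 4 * z)) * (a * p * (1 - a * p / 2) * (1 - p) ^ y) =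
            ((n * p) * ((1 - 4 * z) * (1 - a * p / 2)) * a) * (1 - p) ^ y := by ring
        rw [e5]
        refine mul_le_mul_of_nonneg_right (mul_le_mul_of_nonneg_right ?_ (Nat.cast_nonneg _)) hρ
        have h6 : d ≤ n * p := by
          rw [hd]
          nlinarith
        -- Missing vertices cost 4/D and overlapping neighbourhoods at most 1/D, a loss of at most 5
        -- out of d.
        have h7 : 1 - 5 * z ≤ (1 - 4 * z) * (1 - a * p / 2) := by
          nlinarith
        calc d - 6 ≤ d * (1 - 5 * z) := by nlinarith
          _ ≤ d * ((1 - 4 * z) * (1 - a * p / 2)) := by gcongr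
          _ ≤ _ := by
            refine mul_le_mul_of_nonneg_right h6 (mul_nonneg h4 ?_)
            nlinarith
    _ ≤ w * frontierProb p a y :=
        mul_le_mul hw' (frontierProb_ge hp0 hp1 a y)
          (mul_nonneg (mul_nonneg hap0 (by nlinarith)) hρ) (Nat.cast_nonneg _)

/-- The parameters of the theorem. -/
structure Regime (n : ℕ) (p d : ℝ) : Prop where
  p_nonneg : 0 ≤ p
  p_le : p ≤ 1 / 2
  d_eq : d = ((n : ℝ) - 1) * p
  log_ge : 14 ≤ Real.log n
  d_ge : 1900 * Real.log n ≤ d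
  d_le : d + 1 ≤ n

lemma Regime.exists_depth {n : ℕ} {p d : ℝ} (h : Regime n p d) :
    ∃ K : ℕ, (d + 1) ^ (K + 1) ≤ n ∧ (n : ℝ) < (d + 1) ^ (K + 2) := by
  have hd := h.d_ge
  have hl := h.log_ge
  obtain ⟨K, hK1, hK2⟩ := exists_nat_pow_near (x := (n : ℝ) / (d + 1)) (y := d + 1)
    ((one_le_div (by linarith)).2 h.d_le) (by linarith)
  rw [le_div_iff₀ (by linarith), ← pow_succ] at hK1
  rw [div_lt_iff₀ (by linarith), ← pow_succ] at hK2
  exact ⟨K, hK1, hK2⟩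

/-- The base exceeds e. Logarithmic depth keeps the accumulated loss 6i/d negligible, since d is at
least 1900 log n. -/
lemma Regime.depth_le_log {n : ℕ} {p d : ℝ} (h : Regime n p d) {K : ℕ}
    (hK : (d + 1) ^ K ≤ n) : (K : ℝ) ≤ Real.log n := by
  have hd := h.d_ge
  have hl := h.log_ge
  have h1 : Real.exp K ≤ n := by
    refine le_trans ?_ hK
    rw [← Real.exp_one_pow]
    exact pow_le_pow_left₀ (Real.exp_nonneg _) (by linarith [Real.exp_one_lt_d9]) _
  have := Real.log_le_log (Real.exp_pos _) h1
  rwa [Real.log_exp] at this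

lemma Regime.layerSize_ge {n : ℕ} {p d : ℝ} (h : Regime n p d) {i : ℕ}
    (hi : (i : ℝ) ≤ Real.log n) : 0.74 * d ^ i ≤ layerSize d i := by
  have hd := h.d_ge
  have hl := h.log_ge
  refine le_trans ?_ (le_layerSize (by linarith) i)
  have h1 : 0 ≤ (1 / 2 : ℝ) ^ i := by positivity
  have h2 : 6 * i / d ≤ 6 / 1900 := by
    rw [div_le_div_iff₀ (by linarith) (by norm_num)]
    nlinarith
  have hd0 : 0 ≤ d := by linarith
  gcongr
  norm_num at h2 ⊢
  linarith

/-- The concentration bound for an intermediate layer. -/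
lemma Regime.layer_exponent_ge {n : ℕ} {p d : ℝ} (h : Regime n p d) {i : ℕ}
    (hi : (i : ℝ) ≤ Real.log n) :
    2 * Real.log n ≤ ((1 / 2) ^ i / 8) ^ 2 * ((d - 6) * layerSize d i) / 2 := by
  have hd := h.d_ge
  have hl := h.log_ge
  have h1 := h.layerSize_ge hi
  -- The squared deviation shrinks by a factor 4 per layer while the layer grows by almost d, so the
  -- first layer is the worst case.
  have h2 : 1 ≤ ((1 / 2 : ℝ) ^ 2 * d) ^ i := one_le_pow₀ (by norm_num; linarith)
  have hd0 : 0 ≤ d := by linarith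
  calc 2 * Real.log n ≤ 1 / 64 * (0.99 * d * 0.74) / 2 * 1 := by linarith
    _ ≤ 1 / 64 * (0.99 * d * 0.74) / 2 * ((1 / 2 : ℝ) ^ 2 * d) ^ i := by gcongr
    _ = ((1 / 2) ^ i / 8) ^ 2 * (0.99 * d * (0.74 * d ^ i)) / 2 := by
        rw [mul_pow, ← pow_mul, mul_comm 2 i, pow_mul]
        ring
    _ ≤ _ := by
        gcongr <;> linarith

/-- The expected size of the last layer. -/
lemma Regime.last_layer_ge {n : ℕ} {p d : ℝ} (h : Regime n p d) {k y : ℕ}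
    (hk1 : (d + 1) ^ (k + 2) ≤ n) (hk2 : (n : ℝ) < (d + 1) ^ (k + 3))
    (hy : (y : ℝ) ≤ 2 * (d + 1) ^ (k + 1)) :
    16 * Real.log n ≤ (d - 6) * layerSize d k * (1 - p) ^ y ∧
      n / (3 * d ^ 2) ≤ (1 - 1 / 2) * ((d - 6) * layerSize d k * (1 - p) ^ y) := by
  have hd := h.d_ge
  have hl := h.log_ge
  have hp := h.p_nonneg
  have hp2 := h.p_le
  have hdn := h.d_le
  have hkl := h.depth_le_log hk1
  push_cast at hkl
  have hls := h.layerSize_ge (i := k) (by linarith)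
  have hd0 : 0 < d := by linarith
  have hn0 : (0 : ℝ) < n := by linarith
  set D := d + 1 with hD
  have hD0 : 0 < D := by linarith
  have hDk : D ≤ D ^ (k + 1) := le_self_pow₀ (by linarith) (by omega)
  have hDk0 : 0 < D ^ (k + 1) := by positivity
  have hdk : 0.999 * D ^ (k + 1) ≤ d ^ (k + 1) := by
    have h1 := one_add_mul_le_pow (a := -(1 / D)) (by
      have : 1 / D ≤ 1 := (div_le_one hD0).2 (by linarith)
      linarith) (k + 1)
    have h2 : 1 + -(1 / D) = d / D := by
      field_simp
      rw [hD]
      ring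
    rw [h2, div_pow, le_div_iff₀ hDk0] at h1
    refine le_trans ?_ h1
    gcongr
    have h3 : ((k + 1 : ℕ) : ℝ) * (1 / D) ≤ 0.001 := by
      push_cast
      rw [mul_one_div, div_le_iff₀ hD0]
      linarith
    linarith
  have hmain : 0.729 * D ^ (k + 1) ≤ (d - 6) * layerSize d k := by
    calc 0.729 * D ^ (k + 1) ≤ 0.73 * d ^ (k + 1) := by linarith
      _ ≤ (0.99 * d) * (0.74 * d ^ k) := by
        rw [pow_succ]
        have : 0 ≤ d ^ k * d := by positivity
        linarith
      _ ≤ _ := by gcongr <;> linarith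
  have hpD : p * D ^ (k + 1) ≤ D ^ (k + 2) / n := by
    rw [le_div_iff₀ hn0, pow_succ _ (k + 1)]
    have h1 : p * n ≤ D := by
      have : d = n * p - p := by rw [h.d_eq]; ring
      linarith
    nlinarith
  have hρ : 0 ≤ (1 - p) ^ y := pow_nonneg (by linarith) _
  have hpy : p * y ≤ 2 * (D ^ (k + 2) / n) := by nlinarith
  have hx1 : D ^ (k + 2) / n ≤ 1 := (div_le_one hn0).2 hk1
  have hρ60 : 1 / 60 ≤ (1 - p) ^ y := by
    refine exp_neg_four_ge.trans (le_trans ?_ (exp_neg_two_mul_le_one_sub_pow hp hp2 y))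
    exact Real.exp_le_exp.2 (by linarith)
  have hμ : 0.729 * D ^ (k + 1) * (1 / 60) ≤ (d - 6) * layerSize d k * (1 - p) ^ y :=
    mul_le_mul hmain hρ60 (by norm_num) ((by positivity : (0 : ℝ) ≤ _).trans hmain)
  refine ⟨by linarith, ?_⟩
  rw [div_le_iff₀ (by positivity)]
  -- If this ratio is small, `Y` blocks almost nothing, and n < D^(k+3) suffices with constants near
  -- 1. Otherwise n ≤ 200 D^(k+2), and the spare factor d outweighs the loss 1/60.
  rcases le_total (D ^ (k + 2) / n) (1 / 200) with hx | hx
  · have hρ99 : 0.98 ≤ (1 - p) ^ y := by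
      have h1 := one_add_mul_le_pow (a := -p) (by linarith) y
      rw [← sub_eq_add_neg] at h1
      linarith
    have hμ2 : 0.729 * D ^ (k + 1) * 0.98 ≤ (d - 6) * layerSize d k * (1 - p) ^ y :=
      mul_le_mul hmain hρ99 (by norm_num) ((by positivity : (0 : ℝ) ≤ _).trans hmain)
    have h2 : D ^ 2 ≤ 1.001 * d ^ 2 := by
      rw [hD]
      nlinarith
    calc (n : ℝ) ≤ D ^ (k + 3) := hk2.le
      _ = D ^ (k + 1) * D ^ 2 := by ring
      _ ≤ D ^ (k + 1) * (1.001 * d ^ 2) := by gcongr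
      _ ≤ (1 - 1 / 2) * (0.729 * D ^ (k + 1) * 0.98) * (3 * d ^ 2) := by
        have : 0 ≤ D ^ (k + 1) * d ^ 2 := by positivity
        linarith
      _ ≤ _ := by gcongr
  · rw [div_le_div_iff₀ (by norm_num) hn0] at hx
    calc (n : ℝ) ≤ 200 * D ^ (k + 1) * D := by
          rw [mul_assoc, ← pow_succ]
          linarith
      _ ≤ (1 - 1 / 2) * (0.729 * D ^ (k + 1) * (1 / 60)) * (3 * d ^ 2) := by
        have h5 : 200 * D ≤ 0.018 * d ^ 2 := by nlinarith
        nlinarith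
      _ ≤ _ := by gcongr

end Numeric

/-! ### Non-edges are ruled out by many vertices -/

section Regime

variable {n : ℕ} {p : unitInterval} {d : ℝ}

open Classical in
/-- A non-edge is ruled out by at least `n / (3 d ^ 2)` vertices, except with probability at
most `2 / n`. -/
lemma Regime.integral_few_distinguishing_le (h : Regime n p d) {u v : Fin n} (huv : u ≠ v) :
    ∫ G, ind (¬ G.Adj u v ∧
        (Finset.univ.filter fun s => Distinguishes G u v s).card < ⌈n / (3 * d ^ 2)⌉₊)
      ∂(SimpleGraph.binomialRandom (Fin n) p) ≤ 2 / n := by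
  have hd := h.d_ge
  have hl := h.log_ge
  have hdn := h.d_le
  have hd0 : 0 < d := by linarith
  have hn0 : (0 : ℝ) < n := by linarith
  obtain ⟨K, hK1, hK2⟩ := h.exists_depth
  cases K with
  | zero =>
    -- Here n < D², so a single vertex is required and `u` itself serves.
    have hr : ⌈n / (3 * d ^ 2)⌉₊ ≤ 1 := by
      rw [Nat.ceil_le, Nat.cast_one, div_le_one (by positivity)]
      refine hK2.le.trans ?_
      rw [zero_add]
      nlinarith
    have h0 : ∀ G : SimpleGraph (Fin n), ind (¬ G.Adj u v ∧
        (Finset.univ.filter fun s => Distinguishes G u v s).card < ⌈n / (3 * d ^ 2)⌉₊) = 0 := by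
      refine fun G => ind_false ?_
      rintro ⟨h1, h2⟩
      have h3 : 0 < (Finset.univ.filter fun s => Distinguishes G u v s).card :=
        Finset.card_pos.2 ⟨u, by simpa using distinguishes_self huv h1⟩
      omega
    simp_rw [h0]
    rw [integral_graph_const]
    positivity
  | succ k =>
    set D := d + 1 with hD
    have hD0 : 0 < D := by linarith
    have hkl := h.depth_le_log hK1
    push_cast at hkl
    have hDk : D ^ (k + 1) ≤ n / D := by
      rw [le_div_iff₀ hD0, ← pow_succ]
      exact hK1
    -- The search from `v` uses at most 2n/D vertices and the layers from `u` at most n/D.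
    set N := ⌊n - 3 * n / D⌋₊ with hN
    have hN1 : (n : ℝ) - 3 * n / D ≤ N + 1 := (Nat.lt_floor_add_one _).le
    have hN2 : (N : ℝ) ≤ n - 3 * n / D := by
      refine Nat.floor_le ?_
      rw [sub_nonneg, div_le_iff₀ hD0]
      nlinarith
    have hd10 : 10 ≤ d := by linarith
    have hsize : ∀ i ≤ k, layerSize d i * (d * (d + 1)) ≤ n := by
      intro i hi
      calc layerSize d i * (d * (d + 1)) ≤ d ^ i * (d * (d + 1)) := by
            gcongr
            exact layerSize_le hd10 i
        _ ≤ D ^ k * (D * D) := by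
            have : d ^ i ≤ D ^ k := by
              calc d ^ i ≤ d ^ k := pow_le_pow_right₀ (by linarith) hi
                _ ≤ D ^ k := pow_le_pow_left₀ hd0.le (by linarith) _
            gcongr
            linarith
        _ = D ^ (k + 1 + 1) := by ring
        _ ≤ n := hK1
    have hη : Real.exp (-(2 * Real.log n)) = 1 / n ^ 2 := by
      rw [Real.exp_neg, two_mul, Real.exp_add, Real.exp_log hn0]
      field_simp
    refine (DistanceQuery.integral_few_distinguishing_le p huv (m := layerSize d) (k := k) (N := N)
      (η := Real.exp (-(2 * Real.log n))) (by rw [Fintype.card_fin]; exact h.d_eq) hd0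
      ?_ ?_ (Real.exp_nonneg _) rfl ?_).trans ?_
    · intro i hi A W hAW hA hW
      have hmean := frontier_mean_ge (y := 0) h.p_nonneg p.2.2 h.d_eq hd10 hdn (hsize i hi.le)
        hN1 hW
      rw [pow_zero, mul_one, ← hA] at hmean
      have hm := half_pow_div_mem i
      refine (integral_card_frontier_lt_le p hm.1 (by linarith) (Finset.disjoint_empty_right _) hAW
        (Finset.disjoint_empty_left _) hmean ?_).trans ?_
      · rw [hA]
        exact (Nat.ceil_lt_add_one (mul_nonneg (by linarith)
          (mul_nonneg (by linarith) (Nat.cast_nonneg _)))).le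
      · refine Real.exp_le_exp.2 (neg_le_neg ?_)
        rw [hA]
        have hik : (i : ℝ) ≤ k := by exact_mod_cast hi.le
        exact h.layer_exponent_ge (by linarith)
    · intro A Y W hAW hAY hYW hA hW hY
      have hmean := frontier_mean_ge (y := Y.card) h.p_nonneg p.2.2 h.d_eq hd10 hdn
        (hsize k le_rfl) hN1 hW
      obtain ⟨h1, h2⟩ := h.last_layer_ge hK1 hK2 hY
      rw [← hA] at hmean h1 h2
      refine (integral_card_frontier_lt_le p (δ := 1 / 2) (by norm_num) (by norm_num) hAY hAW hYW
        hmean ?_).trans ?_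
      · refine (Nat.ceil_lt_add_one (by positivity)).le.trans ?_
        linarith
      · refine Real.exp_le_exp.2 ?_
        linarith
    · rw [Fintype.card_fin]
      have h1 := sum_layerSize_le hd10 k
      have h2 : 3 * n / D = 3 * (n / D) := by ring
      linarith
    · have h1 : Real.exp (-(d / 6)) ≤ 1 / n := by
        calc Real.exp (-(d / 6)) ≤ Real.exp (-(Real.log n)) := Real.exp_le_exp.2 (by linarith)
          _ = 1 / n := by rw [Real.exp_neg, Real.exp_log hn0, one_div]
      have h2 : (k + 1 : ℝ) ≤ n := by
        linarith [Real.log_le_sub_one_of_pos hn0]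
      rw [hη]
      calc _ ≤ 1 / (n : ℝ) + n * (1 / n ^ 2) := by gcongr
        _ = 2 / n := by field_simp; norm_num

end Regime

/-! ### Random samples that avoid a given set -/

section Sampling

/-- The probability that a random set of `m` elements avoids a given set of `r` elements. -/
lemma descFactorial_sub_le (n r m : ℕ) (hr : r ≤ n) :
    ((n - r).descFactorial m : ℝ) ≤ (1 - r / n) ^ m * n.descFactorial m := by
  rcases Nat.eq_zero_or_pos n with rfl | hn
  · obtain rfl : r = 0 := by omega
    simp
  have hn0 : (0 : ℝ) < n := by exact_mod_cast hn
  have hrn : (r : ℝ) ≤ n := by exact_mod_cast hr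
  have hq : 0 ≤ 1 - (r : ℝ) / n := by
    rw [sub_nonneg, div_le_one hn0]
    exact hrn
  induction m with
  | zero => simp
  | succ m ih =>
    rw [Nat.descFactorial_succ, Nat.descFactorial_succ, pow_succ]
    push_cast
    rcases le_or_gt (n - r) m with h | h
    · rw [Nat.sub_eq_zero_of_le h]
      simp only [Nat.cast_zero, zero_mul]
      positivity
    · have h1 : ((n - r - m : ℕ) : ℝ) ≤ (1 - r / n) * (n - m : ℕ) := by
        rw [Nat.cast_sub h.le, Nat.cast_sub hr, Nat.cast_sub (by omega)]
        have h2 : (r : ℝ) / n * m ≤ m := by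
          refine mul_le_of_le_one_left (Nat.cast_nonneg _) ((div_le_one hn0).2 hrn)
        have h3 : (r : ℝ) / n * n = r := by field_simp
        nlinarith
      calc ((n - r - m : ℕ) : ℝ) * (n - r).descFactorial m
          ≤ ((1 - r / n) * (n - m : ℕ)) * ((1 - r / n) ^ m * n.descFactorial m) := by gcongr
        _ = _ := by ring

lemma choose_sub_le_exp (n r m : ℕ) (hr : r ≤ n) :
    ((n - r).choose m : ℝ) ≤ Real.exp (-(r * m / n)) * n.choose m := by
  have h1 := descFactorial_sub_le n r m hr
  rw [Nat.descFactorial_eq_factorial_mul_choose, Nat.descFactorial_eq_factorial_mul_choose] at h1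
  push_cast at h1
  have hm : (0 : ℝ) < m.factorial := by exact_mod_cast m.factorial_pos
  have h2 : ((n - r).choose m : ℝ) ≤ (1 - r / n) ^ m * n.choose m := by
    refine le_of_mul_le_mul_left ?_ hm
    linarith
  refine h2.trans (mul_le_mul_of_nonneg_right ?_ (Nat.cast_nonneg _))
  have hq : 0 ≤ 1 - (r : ℝ) / n := by
    rw [sub_nonneg]
    exact div_le_one_of_le₀ (by exact_mod_cast hr) (Nat.cast_nonneg _)
  calc (1 - (r : ℝ) / n) ^ m ≤ Real.exp (-(r / n)) ^ m :=
        pow_le_pow_left₀ hq (by linarith [Real.add_one_le_exp (-((r : ℝ) / n))]) _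
    _ = Real.exp (-(r * m / n)) := by
        rw [← Real.exp_nat_mul]
        ring_nf

/-- The average over the sets `S` of size `m` of the indicator of avoiding `R`. -/
lemma sum_ind_disjoint {V : Type*} [Fintype V] [DecidableEq V] (R : Finset V) (m : ℕ) :
    ∑ S ∈ (Finset.univ : Finset V).powersetCard m, ind (∀ s ∈ S, s ∉ R) =
      (Fintype.card V - R.card).choose m := by
  classical
  have h : ∀ S : Finset V, ind (∀ s ∈ S, s ∉ R) = if ∀ s ∈ S, s ∉ R then 1 else 0 := by
    intro S
    simp [ind]
  simp_rw [h]
  rw [Finset.sum_boole, ← Finset.card_compl, ← Finset.card_powersetCard]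
  congr 2
  ext S
  simp [Finset.mem_powersetCard, Finset.subset_iff, and_comm]

end Sampling

/-! ### Correctness and expected cost of the algorithm -/

section Algorithm

namespace Algorithm

variable {V α : Type} [DecidableEq V]

open Classical in
lemma run_askAll (G : SimpleGraph V) (l : List (V × V)) (d : V → V → ℕ∞)
    (next : (V → V → ℕ∞) → Algorithm V α) :
    (askAll l d next).run G =
      (next fun x y => if (x, y) ∈ l then G.edist x y else d x y).run G := by
  induction l generalizing d with
  | nil => simp [askAll]
  | cons e l ih =>
    obtain ⟨u, v⟩ := e
    rw [askAll, run, ih]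
    congr 2
    ext x y
    by_cases h1 : (x, y) ∈ l
    · simp [h1]
    · by_cases h2 : x = u ∧ y = v
      · obtain ⟨rfl, rfl⟩ := h2
        simp
      · simp [h1, h2]

open Classical in
lemma queries_askAll (G : SimpleGraph V) (l : List (V × V)) (d : V → V → ℕ∞)
    (next : (V → V → ℕ∞) → Algorithm V α) :
    (askAll l d next).queries G = l.length +
      (next fun x y => if (x, y) ∈ l then G.edist x y else d x y).queries G := by
  induction l generalizing d with
  | nil => simp [askAll]
  | cons e l ih =>
    obtain ⟨u, v⟩ := e
    rw [askAll, queries, ih, List.length_cons, add_right_comm]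
    congr 3
    ext x y
    by_cases h1 : (x, y) ∈ l
    · simp [h1]
    · by_cases h2 : x = u ∧ y = v
      · obtain ⟨rfl, rfl⟩ := h2
        simp
      · simp [h1, h2]

end Algorithm

variable {n : ℕ}

/-- Only rows indexed by `S` are read, so the default 0 at pairs never asked in the first step is
irrelevant. -/
lemma pseudoEdges_congr (S : Finset (Fin n)) {d d' : Fin n → Fin n → ℕ∞}
    (h : ∀ s ∈ S, ∀ x, d s x = d' s x) : pseudoEdges S d = pseudoEdges S d' := by
  ext e
  simp only [pseudoEdges, Finset.mem_filter, Finset.mem_univ, true_and]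
  refine and_congr_right fun _ => forall₂_congr fun s hs => ?_
  rw [h s hs, h s hs]

lemma mem_pseudoEdges_edist {G : SimpleGraph (Fin n)} {S : Finset (Fin n)} {u v : Fin n} :
    (u, v) ∈ pseudoEdges S G.edist ↔ u < v ∧ ∀ s ∈ S, ¬ Distinguishes G u v s := by
  simp [pseudoEdges, Distinguishes]

lemma not_distinguishes_of_adj {G : SimpleGraph (Fin n)} {u v : Fin n} (h : G.Adj u v)
    (s : Fin n) : ¬ Distinguishes G u v s :=
  not_not.2 ⟨edist_le_edist_add_one_of_adj h.symm s, edist_le_edist_add_one_of_adj h s⟩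

lemma queries_pseudoEdgeAlgorithm (S : Finset (Fin n)) (G : SimpleGraph (Fin n)) :
    (pseudoEdgeAlgorithm S).queries G = S.card * n + (pseudoEdges S G.edist).card := by
  classical
  rw [pseudoEdgeAlgorithm, Algorithm.queries_askAll, Algorithm.queries_askAll, Algorithm.queries,
    add_zero, Finset.length_toList, Finset.length_toList, Finset.card_product, Finset.card_univ,
    Fintype.card_fin]
  congr 2
  refine pseudoEdges_congr S fun s hs x => ?_
  simp [hs]

lemma run_pseudoEdgeAlgorithm (S : Finset (Fin n)) (G : SimpleGraph (Fin n)) :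
    (pseudoEdgeAlgorithm S).run G = G := by
  classical
  rw [pseudoEdgeAlgorithm, Algorithm.run_askAll, Algorithm.run_askAll, Algorithm.run]
  rw [pseudoEdges_congr S (d' := G.edist) fun s hs x => by simp [hs]]
  ext u v
  have hlt : ∀ {u v : Fin n}, (u, v) ∈ pseudoEdges S G.edist ∧ G.edist u v = 1 ↔
      u < v ∧ G.Adj u v := by
    intro u v
    rw [mem_pseudoEdges_edist, SimpleGraph.edist_eq_one_iff_adj]
    exact ⟨fun h => ⟨h.1.1, h.2⟩, fun h => ⟨⟨h.1, fun s _ => not_distinguishes_of_adj h.2 s⟩, h.2⟩⟩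
  have hif : ∀ {u v : Fin n}, ((u, v) ∈ pseudoEdges S G.edist ∧
      (if (u, v) ∈ (pseudoEdges S G.edist).toList then G.edist u v else 0) = 1) ↔
      u < v ∧ G.Adj u v := by
    intro u v
    rw [← hlt]
    refine and_congr_right fun h => ?_
    -- A pair that can be output has been queried, so the default entry is not consulted.
    rw [if_pos (Finset.mem_toList.2 h)]
  rw [SimpleGraph.fromRel_adj, hif, hif]
  constructor
  · rintro ⟨-, ⟨-, h⟩ | ⟨-, h⟩⟩
    · exact h
    · exact h.symm
  · intro h
    refine ⟨h.ne, ?_⟩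
    rcases lt_or_gt_of_ne h.ne with h1 | h1
    · exact .inl ⟨h1, h⟩
    · exact .inr ⟨h1, h.symm⟩

lemma randomPseudoEdgeAlgorithm_reconstructs (n m : ℕ) :
    (randomPseudoEdgeAlgorithm n m).Reconstructs := by
  intro T hT G
  rw [randomPseudoEdgeAlgorithm, PMF.mem_support_map_iff] at hT
  obtain ⟨S, -, rfl⟩ := hT
  exact run_pseudoEdgeAlgorithm S G

lemma tsum_map_mul {α β : Type*} (q : PMF α) (f : α → β) (g : β → ℝ≥0∞) :
    ∑' b, q.map f b * g b = ∑' a, q a * g (f a) := by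
  classical
  simp_rw [PMF.map_apply, ← ENNReal.tsum_mul_right]
  rw [ENNReal.tsum_comm]
  refine tsum_congr fun a => ?_
  rw [tsum_eq_single (f a)]
  · simp
  · intro b hb
    simp [hb]

open Classical in
/-- The expected number of queries on a fixed graph. -/
lemma tsum_queries_eq (n m : ℕ) (hm : m ≤ n) (G : SimpleGraph (Fin n)) :
    ∑' T, randomPseudoEdgeAlgorithm n m T * (T.queries G : ℝ≥0∞) =
      ENNReal.ofReal (m * n + ∑ e : Fin n × Fin n, ind (e.1 < e.2) *
        (((n - (Finset.univ.filter fun s => Distinguishes G e.1 e.2 s).card).choose m : ℝ) /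
          n.choose m)) := by
  have hc : (0 : ℝ) < n.choose m := by exact_mod_cast Nat.choose_pos hm
  have hpe : ∀ S : Finset (Fin n), ((pseudoEdges S G.edist).card : ℝ) =
      ∑ e : Fin n × Fin n, ind (e.1 < e.2) *
        ind (∀ s ∈ S, s ∉ Finset.univ.filter fun s => Distinguishes G e.1 e.2 s) := by
    intro S
    have h1 : ∀ e : Fin n × Fin n, ind (e.1 < e.2) *
        ind (∀ s ∈ S, s ∉ Finset.univ.filter fun s => Distinguishes G e.1 e.2 s) =
        if e ∈ pseudoEdges S G.edist then 1 else 0 := by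
      intro e
      rw [← ind_and]
      simp only [Finset.mem_filter, Finset.mem_univ, true_and, ind]
      exact if_congr mem_pseudoEdges_edist.symm rfl rfl
    simp_rw [h1]
    rw [Finset.sum_boole]
    simp
  have hreal : (m * n + ∑ e : Fin n × Fin n, ind (e.1 < e.2) *
        (((n - (Finset.univ.filter fun s => Distinguishes G e.1 e.2 s).card).choose m : ℝ) /
          n.choose m)) =
      ∑ S ∈ (Finset.univ : Finset (Fin n)).powersetCard m,
        (n.choose m : ℝ)⁻¹ * ((m * n + (pseudoEdges S G.edist).card : ℕ) : ℝ) := by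
    push_cast
    simp_rw [hpe, mul_add, Finset.sum_add_distrib]
    congr 1
    · rw [Finset.sum_const, Finset.card_powersetCard, Finset.card_univ, Fintype.card_fin,
        nsmul_eq_mul]
      field_simp
    · simp_rw [Finset.mul_sum]
      rw [Finset.sum_comm]
      refine Finset.sum_congr rfl fun e _ => ?_
      rw [← Finset.mul_sum, ← Finset.mul_sum, sum_ind_disjoint, Fintype.card_fin]
      ring
  rw [randomPseudoEdgeAlgorithm, tsum_map_mul, hreal,
    ENNReal.ofReal_sum_of_nonneg (fun S _ => by positivity)]
  rw [tsum_eq_sum (s := (Finset.univ : Finset (Fin n)).powersetCard m)]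
  · refine Finset.sum_congr rfl fun S hS => ?_
    rw [PMF.uniformOfFinset_apply_of_mem _ (by rwa [min_eq_right hm]),
      queries_pseudoEdgeAlgorithm, ENNReal.ofReal_mul (by positivity), ENNReal.ofReal_natCast,
      ENNReal.ofReal_inv_of_pos hc, ENNReal.ofReal_natCast, min_eq_right hm,
      Finset.card_powersetCard, Finset.card_univ, Fintype.card_fin, (Finset.mem_powersetCard.1 hS).2]
  · intro S hS
    rw [PMF.uniformOfFinset_apply_of_notMem _ (by rwa [min_eq_right hm]), zero_mul]

open Classical in
lemma expectedQueries_eq (n m : ℕ) (hm : m ≤ n) (p : unitInterval) :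
    (randomPseudoEdgeAlgorithm n m).expectedQueries p =
      ENNReal.ofReal (m * n + ∑ e : Fin n × Fin n, ind (e.1 < e.2) *
        ∫ G, ((n - (Finset.univ.filter fun s => Distinguishes G e.1 e.2 s).card).choose m : ℝ) /
          n.choose m ∂(SimpleGraph.binomialRandom (Fin n) p)) := by
  rw [RandomizedAlgorithm.expectedQueries]
  simp_rw [tsum_queries_eq n m hm]
  rw [← ofReal_integral_eq_lintegral_ofReal (integrable_graph p _)]
  · rw [integral_add (integrable_graph p _) (integrable_graph p _), integral_graph_const,
      integral_finsetSum _ fun e _ => integrable_graph p _]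
    simp_rw [integral_const_mul]
  · refine Filter.Eventually.of_forall fun G => ?_
    have : 0 ≤ ∑ e : Fin n × Fin n, ind (e.1 < e.2) *
        (((n - (Finset.univ.filter fun s => Distinguishes G e.1 e.2 s).card).choose m : ℝ) /
          n.choose m) :=
      Finset.sum_nonneg fun e _ => mul_nonneg (ind_nonneg _) (by positivity)
    simp only [Pi.zero_apply]
    positivity

lemma randomPseudoEdgeAlgorithm_min (n m : ℕ) :
    randomPseudoEdgeAlgorithm n (min n m) = randomPseudoEdgeAlgorithm n m := by
  simp [randomPseudoEdgeAlgorithm]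

/-- A pair ruled out by at least `r` vertices survives a sample of `m` vertices with probability at
most `1 / n`. -/
lemma choose_sub_div_choose_le {r R m : ℕ} (hn : 0 < n) (hr : 1 ≤ r) (hrR : r ≤ R) (hR : R ≤ n)
    (hm : m = n ∨ Real.log n ≤ r * m / n) (hmn : m ≤ n) :
    ((n - R).choose m : ℝ) / n.choose m ≤ 1 / n := by
  have hn0 : (0 : ℝ) < n := by exact_mod_cast hn
  have hc : (0 : ℝ) < n.choose m := by exact_mod_cast Nat.choose_pos hmn
  -- If the sample is the whole vertex set, it meets any nonempty set of vertices that rule out the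
  -- pair.
  rcases hm with rfl | hm
  · rw [Nat.choose_eq_zero_of_lt (by omega)]
    simp
  · rw [div_le_iff₀ hc]
    refine (choose_sub_le_exp n R m hR).trans (mul_le_mul_of_nonneg_right ?_ hc.le)
    calc Real.exp (-(R * m / n)) ≤ Real.exp (-(Real.log n)) := by
          refine Real.exp_le_exp.2 (neg_le_neg (hm.trans ?_))
          gcongr
      _ = 1 / n := by rw [Real.exp_neg, Real.exp_log hn0, one_div]

open Classical in
/-- The probability that a pair is queried in the second step. -/
lemma Regime.integral_pair_le {p : unitInterval} {d : ℝ} (h : Regime n p d) {u v : Fin n}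
    (huv : u ≠ v) :
    ∫ G, ((n - (Finset.univ.filter fun s => Distinguishes G u v s).card).choose
        (min n ⌈3 * d ^ 2 * Real.log n⌉₊) : ℝ) / n.choose (min n ⌈3 * d ^ 2 * Real.log n⌉₊)
      ∂(SimpleGraph.binomialRandom (Fin n) p) ≤ p + 3 / n := by
  have hd := h.d_ge
  have hl := h.log_ge
  have hdn := h.d_le
  have hd0 : 0 < d := by linarith
  have hn0 : (0 : ℝ) < n := by linarith
  have hn : 0 < n := by exact_mod_cast hn0
  set m := min n ⌈3 * d ^ 2 * Real.log n⌉₊ with hm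
  set r := ⌈n / (3 * d ^ 2)⌉₊ with hr
  have hmn : m ≤ n := min_le_left _ _
  have hr1 : 1 ≤ r := Nat.one_le_ceil_iff.2 (by positivity)
  have hmr : m = n ∨ Real.log n ≤ r * m / n := by
    rcases min_choice n ⌈3 * d ^ 2 * Real.log n⌉₊ with h1 | h1
    · exact .inl h1
    · right
      rw [hm, h1, le_div_iff₀ hn0]
      calc Real.log n * n = n / (3 * d ^ 2) * (3 * d ^ 2 * Real.log n) := by field_simp
        _ ≤ _ := by
          gcongr
          · exact Nat.le_ceil _
          · exact Nat.le_ceil _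
  have hc : (0 : ℝ) < n.choose m := by exact_mod_cast Nat.choose_pos hmn
  -- A pair survives because it is an edge, because few vertices rule it out, or because the sample
  -- misses all of many.
  have hpt : ∀ G : SimpleGraph (Fin n),
      ((n - (Finset.univ.filter fun s => Distinguishes G u v s).card).choose m : ℝ) /
        n.choose m ≤ ind (G.Adj u v) + ind (¬ G.Adj u v ∧
          (Finset.univ.filter fun s => Distinguishes G u v s).card < r) + 1 / n := by
    intro G
    have h1n : 0 ≤ 1 / (n : ℝ) := by positivity
    set R := (Finset.univ.filter fun s => Distinguishes G u v s).card with hR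
    have hRn : R ≤ n := by
      have := Finset.card_le_univ (Finset.univ.filter fun s => Distinguishes G u v s)
      rwa [Fintype.card_fin] at this
    have hle1 : ((n - R).choose m : ℝ) / n.choose m ≤ 1 := by
      rw [div_le_one hc]
      exact_mod_cast Nat.choose_le_choose m (Nat.sub_le n R)
    by_cases hadj : G.Adj u v
    · rw [ind_true hadj]
      linarith [ind_nonneg (¬ G.Adj u v ∧ R < r)]
    · by_cases hRr : R < r
      · rw [ind_true (P := ¬ G.Adj u v ∧ R < r) ⟨hadj, hRr⟩]
        linarith [ind_nonneg (G.Adj u v)]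
      · linarith [ind_nonneg (G.Adj u v), ind_nonneg (¬ G.Adj u v ∧ R < r),
          choose_sub_div_choose_le hn hr1 (not_lt.1 hRr) hRn hmr hmn]
  refine (integral_graph_mono p hpt).trans ?_
  rw [integral_add (integrable_graph p _) (integrable_graph p _),
    integral_add (integrable_graph p _) (integrable_graph p _), integral_graph_const,
    integral_ind_adj p huv]
  have h1 := h.integral_few_distinguishing_le huv
  have h2 : (3 : ℝ) / n = 2 / n + 1 / n := by ring
  rw [h2]
  linarith

lemma Regime.expectedQueries_le {p : unitInterval} {d : ℝ} (h : Regime n p d) :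
    (randomPseudoEdgeAlgorithm n ⌈3 * d ^ 2 * Real.log n⌉₊).expectedQueries p ≤
      ENNReal.ofReal (10 * (d ^ 2 * n * Real.log n)) := by
  classical
  have hd := h.d_ge
  have hl := h.log_ge
  have hdn := h.d_le
  have hd0 : 0 < d := by linarith
  have hn0 : (0 : ℝ) < n := by linarith
  rw [← randomPseudoEdgeAlgorithm_min, expectedQueries_eq _ _ (min_le_left _ _)]
  refine ENNReal.ofReal_le_ofReal ?_
  have h1 : ((min n ⌈3 * d ^ 2 * Real.log n⌉₊ : ℕ) : ℝ) ≤ 3 * d ^ 2 * Real.log n + 1 :=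
    le_trans (by exact_mod_cast min_le_right _ _) (Nat.ceil_lt_add_one (by positivity)).le
  have hp := h.p_nonneg
  have h2 : ∀ e : Fin n × Fin n, ind (e.1 < e.2) *
        ∫ G, ((n - (Finset.univ.filter fun s => Distinguishes G e.1 e.2 s).card).choose
          (min n ⌈3 * d ^ 2 * Real.log n⌉₊) : ℝ) /
          n.choose (min n ⌈3 * d ^ 2 * Real.log n⌉₊) ∂(SimpleGraph.binomialRandom (Fin n) p) ≤
      p + 3 / n := by
    intro e
    by_cases he : e.1 < e.2
    · rw [ind_true he, one_mul]
      exact h.integral_pair_le he.ne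
    · rw [ind_false he, zero_mul]
      positivity
  have h3 := Finset.sum_le_sum fun e (_ : e ∈ Finset.univ) => h2 e
  rw [Finset.sum_const, Finset.card_univ, Fintype.card_prod, Fintype.card_fin, nsmul_eq_mul] at h3
  have h4 : ((n * n : ℕ) : ℝ) * (p + 3 / n) = n * (n * p + 3) := by
    push_cast
    field_simp
  have h5 : n * (p : ℝ) ≤ d + 1 := by
    have h6 : d = n * p - p := by rw [h.d_eq]; ring
    linarith [h.p_le]
  rw [h4] at h3
  have h7 : d ≤ d ^ 2 * Real.log n := by nlinarith
  calc _ ≤ (3 * d ^ 2 * Real.log n + 1) * n + n * (n * p + 3) := by gcongr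
    _ = n * (3 * (d ^ 2 * Real.log n) + 1 + (n * p + 3)) := by ring
    _ ≤ n * (10 * (d ^ 2 * Real.log n)) := by
      refine mul_le_mul_of_nonneg_left ?_ hn0.le
      linarith
    _ = _ := by ring

/-- For `n ≤ 1` there is nothing to query. -/
lemma expectedQueries_of_le_one (hn : n ≤ 1) (p : unitInterval) :
    (randomPseudoEdgeAlgorithm n 0).expectedQueries p = 0 := by
  have : Subsingleton (Fin n) := Fin.subsingleton_iff_le_one.2 hn
  rw [expectedQueries_eq n 0 (Nat.zero_le n)]
  have h : ∀ e : Fin n × Fin n, ind (e.1 < e.2) = 0 := fun e =>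
    ind_false (by rw [Subsingleton.elim e.1 e.2]; exact lt_irrefl _)
  simp [h]

/-- The two bounds on `p` force 2000 log n ≤ √n. Starting from log n ≥ log 2 this gives √n ≥ 1380,
hence n ≥ e^14. -/
lemma regime_of_bounds {p : unitInterval} (hn : 2 ≤ n) (h1 : 2000 * Real.log n / n ≤ (p : ℝ))
    (h2 : (p : ℝ) ≤ (n : ℝ) ^ (-(1 / 2 : ℝ))) : Regime n p (((n : ℝ) - 1) * p) := by
  have hn2 : (2 : ℝ) ≤ n := by exact_mod_cast hn
  have hn0 : (0 : ℝ) < n := by linarith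
  set x := √(n : ℝ) with hx
  have hx0 : 0 < x := Real.sqrt_pos.2 hn0
  have hxx : x * x = n := Real.mul_self_sqrt hn0.le
  rw [Real.rpow_neg hn0.le, ← Real.sqrt_eq_rpow, ← hx] at h2
  have h3 : 2000 * Real.log n ≤ x := by
    have h4 := (div_le_iff₀ hn0).1 (h1.trans h2)
    rwa [← hxx, inv_mul_cancel_left₀ hx0.ne', hxx] at h4
  have hlog2 : 0.69 ≤ Real.log n :=
    le_trans (by linarith [Real.log_two_gt_d9]) (Real.log_le_log (by norm_num) hn2)
  have hx1 : 1380 ≤ x := by linarith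
  have hlog : 14 ≤ Real.log n := by
    rw [Real.le_log_iff_exp_le hn0]
    calc Real.exp 14 = Real.exp 1 ^ 14 := by rw [← Real.exp_nat_mul]; norm_num
      _ ≤ 2.7183 ^ 14 := pow_le_pow_left₀ (Real.exp_nonneg _)
          (by linarith [Real.exp_one_lt_d9]) _
      _ ≤ 1380 * 1380 := by norm_num
      _ ≤ n := by rw [← hxx]; gcongr
  have hpx : (p : ℝ) * x ≤ 1 := by
    calc (p : ℝ) * x ≤ x⁻¹ * x := by gcongr
      _ = 1 := inv_mul_cancel₀ hx0.ne'
  have hp0 := p.2.1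
  rw [div_le_iff₀ hn0] at h1
  have hp2 : (p : ℝ) ≤ 1 / 2 := by nlinarith
  refine ⟨hp0, hp2, rfl, hlog, by linarith, ?_⟩
  rw [← hxx]
  nlinarith

end Algorithm

end DistanceQuery

theorem theorem1 :
    ∃ C : ℝ, ∀ ε : ℝ, 0 ≤ ε → ∀ (n : ℕ) (p : unitInterval),
      2000 * Real.log n / n ≤ (p : ℝ) → (p : ℝ) ≤ (n : ℝ) ^ (-(1 / 2 : ℝ) - ε) →
      ∀ Δ : ℝ, Δ = ((n : ℝ) - 1) * p →
        (DistanceQuery.randomPseudoEdgeAlgorithm n ⌈3 * Δ ^ 2 * Real.log n⌉₊).Reconstructs ∧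
        (DistanceQuery.randomPseudoEdgeAlgorithm n ⌈3 * Δ ^ 2 * Real.log n⌉₊).expectedQueries p
          ≤ ENNReal.ofReal (C * (Δ ^ 2 * n * Real.log n)) := by
  -- Three units pay for querying `S`; the rest generously covers rounding, edges and surviving
  -- non-edges.
  refine ⟨10, ?_⟩
  rintro ε hε n p h1 h2 Δ rfl
  refine ⟨DistanceQuery.randomPseudoEdgeAlgorithm_reconstructs n _, ?_⟩
  rcases le_or_gt n 1 with hn | hn
  -- Both the sample size and the claimed bound are zero here.
  · have hlog : Real.log n = 0 := by interval_cases n <;> simp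
    simp [hlog, DistanceQuery.expectedQueries_of_le_one hn]
  · refine (DistanceQuery.regime_of_bounds hn h1 (h2.trans ?_)).expectedQueries_le
    exact Real.rpow_le_rpow_of_exponent_le (by exact_mod_cast hn.le) (by linarith)
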